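/- **Proposition (Estimate of difference quotients).** Conventions. For a measurable $f$ on $\mathbb{R}^N$ put $|||f|||_{M^1}=\sup_{\lambda>0}\lambda\,\mathscr L^N(\{|f|>\lambda\})$; $M^1(\mathbb{R}^N)$ is the set of measurable $f$ with $|||f|||_{M^1}<\infty$. A *singular kernel of fundamental type* is a tempered distribution $K\in\mathcal S'(\mathbb{R}^N)$ with $\widehat K\in L^\infty(\mathbb{R}^N)$ whose restriction to $\mathbb{R}^N\setminus\{0\}$ is a $C^1$ function such that, for some constants $C_0,C_1,A_2\ge 0$, $|K(x)|\le C_0|x|^{-N}$ and $|\nabla K(x)|\le C_1|x|^{-N-1}$ for all $x\neq0$, and $\bigl|\int_{R_1<|x|<R_2}K(x)\,dx\bigr|\le A_2$ for all $0<R_1<R_2<\infty$. The associated singular integral operator $S$ acts by $S\varphi=K*\varphi$, i.e. $\widehat{S\varphi}=\widehat K\,\widehat\varphi$, and it maps a finite (signed) measure $g$ to the tempered distribution $Sg$ given by $\langle Sg,\varphi\rangle=\int \widetilde S\varphi\,dg$ for $\varphi\in\mathcal S(\mathbb{R}^N)$, where $\widetilde S$ is the operator with kernel $\widetilde K(x)=K(-x)$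 and $\widetilde S\varphi$ denotes the continuous representative. For a family $\{\rho^\nu\}_\nu\subset C^\infty_c(\mathbb{R}^N)$ and a tempered distribution $T$ put $$M_{\{\rho^\nu\}}(T)(x)=\sup_\nu\sup_{\varepsilon>0}\bigl|\langle T,\rho^\nu_\varepsilon(x-\cdot)\rangle\bigr|,\qquad \rho^\nu_\varepsilon(z)=\varepsilon^{-N}\rho^\nu(z/\varepsilon).$$ Statement. Let $u\in L^1_{\rm loc}(\mathbb{R}^N)$ be real-valued and assume that for every $j=1,\dots,N$ $$\partial_j u=\sum_{k=1}^m S_{jk}g_{jk}\qquad\text{in }\mathcal D'(\mathbb{R}^N),$$ where the $S_{jk}$ are singular integral operators associated to singular kernels of fundamental type and the $g_{jk}$ are finite (signed) measures on $\mathbb{R}^N$. Then there exist a nonnegative function $U\in M^1(\mathbb{R}^N)$ and an $\mathscr L^N$-negligible set $\mathcal N\subset\mathbb{R}^N$ such that $$|u(x)-u(y)|\le|x-y|\,\bigl(U(x)+U(y)\bigr)\qquad\text{for all }x,y\in\mathbb{R}^N\setminus\mathcal N.$$ Moreover, for every $h\in C^\infty_c(\mathbb{R}^N)$, real-valued, with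 $\int h=1$ and ${\rm spt}\,h\subset B_{1/2}$ (the open ball of radius $1/2$ centred at $0$), one can take $U$ to be $$U=\sum_{j=1}^N\sum_{k=1}^m M_{\{\Upsilon^{\xi,j},\ \xi\in\mathbb S^{N-1}\}}(S_{jk}g_{jk}),\qquad \Upsilon^{\xi,j}(w)=h\Bigl(\frac{\xi}{2}-w\Bigr)w_j ,$$ which is a $[0,\infty]$-valued function in $M^1(\mathbb{R}^N)$, finite outside $\mathcal N$. -/

import Mathlib

open MeasureTheory Set Filter Topology
open scoped ENNReal ContDiff SchwartzMap FourierTransform Distributions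

noncomputable section

namespace DiffQuot

/-- The Euclidean space `ℝ^N`. -/
abbrev Euc (N : ℕ) := EuclideanSpace ℝ (Fin N)

/-! ### The weak Lebesgue space `M^1(ℝ^N)` -/

/-- The weak quasi-norm `|||f|||_{M^1} = sup_{t > 0} t · |{x : |f x| > t}|`. -/
def weakNorm {N : ℕ} {ε : Type*} [ENorm ε] (f : Euc N → ε) : ℝ≥0∞ :=
  ⨆ (t : ℝ) (_ : 0 < t), ENNReal.ofReal t * volume {x | ENNReal.ofReal t < ‖f x‖ₑ}

/-- `f ∈ M^1(ℝ^N)`: `f` is Lebesgue measurable with finite weak quasi-norm. Values may lie in `ℝ`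
or in `[0, ∞]`; in the second case finiteness of the quasi-norm forces `f < ∞` a.e. -/
def MemM1 {N : ℕ} {ε : Type*} [TopologicalSpace ε] [ENorm ε] (f : Euc N → ε) : Prop :=
  AEStronglyMeasurable f volume ∧ weakNorm f < ⊤

/-! ### Singular kernels of fundamental type -/

/-- A singular kernel of fundamental type on `ℝ^N`: a tempered distribution `K` with
`𝓕 K ∈ L^∞`, which coincides on `ℝ^N \ {0}` with a `C^1` function `k` such that
`|k(x)| ≤ C₀ |x|^{-N}`, `|∇k(x)| ≤ C₁ |x|^{-N-1}`, and `|∫_{R₁<|x|<R₂} k| ≤ A₂`.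
(Hörmander's condition `∫_{|x|>2|y|} |k(x-y) - k(x)| dx ≤ A` follows from the gradient bound.) -/
structure FundamentalKernel (N : ℕ) where
  /-- the kernel `K`, as a tempered distribution -/
  dist : 𝓢'(Euc N, ℂ)
  /-- its Fourier transform, a bounded function -/
  symbol : Lp ℂ ⊤ (volume : Measure (Euc N))
  fourier_dist : 𝓕 dist = Lp.toTemperedDistribution symbol
  /-- the function `k` which represents `K` away from the origin -/
  offOrigin : Euc N → ℂ
  dist_apply : ∀ φ : 𝓢(Euc N, ℂ), HasCompactSupport φ → (0 : Euc N) ∉ tsupport φ →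
    dist φ = ∫ x, offOrigin x * φ x
  contDiffOn : ContDiffOn ℝ 1 offOrigin {0}ᶜ
  size_bound : ∃ C₀ : ℝ, ∀ x, x ≠ 0 → ‖offOrigin x‖ ≤ C₀ / ‖x‖ ^ N
  gradient_bound : ∃ C₁ : ℝ, ∀ x, x ≠ 0 → ‖fderiv ℝ offOrigin x‖ ≤ C₁ / ‖x‖ ^ (N + 1)
  cancellation : ∃ A₂ : ℝ, ∀ R₁ R₂ : ℝ, 0 < R₁ → R₁ < R₂ →
    ‖∫ x in {x : Euc N | R₁ < ‖x‖ ∧ ‖x‖ < R₂}, offOrigin x‖ ≤ A₂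

/-! ### Singular integral operators acting on finite measures -/

/-- Convolution of a Schwartz function `φ` with the kernel whose Fourier transform is `m`, in the
sense of multiplication in the Fourier variable: `𝓕⁻¹ (m · 𝓕 φ)`. For bounded `m` the product
`m · 𝓕 φ` is integrable, and this is the continuous representative. -/
def fourierMult {N : ℕ} (m : Euc N → ℂ) (φ : 𝓢(Euc N, ℂ)) : Euc N → ℂ :=
  𝓕⁻ (fun ξ => m ξ * 𝓕 φ ξ)

/-- `∫ f dg` for a complex function `f` and a finite signed measure `g`. -/
def integralSigned {N : ℕ} (f : Euc N → ℂ) (g : SignedMeasure (Euc N)) : ℂ :=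
  ∫ x, f x ∂g.toJordanDecomposition.posPart - ∫ x, f x ∂g.toJordanDecomposition.negPart

namespace FundamentalKernel

variable {N : ℕ}

/-- `S̃ φ` for `φ` Schwartz, where `S̃` is the singular integral operator associated to the
reflected kernel `K̃(x) = K(-x)`, whose Fourier transform is `ξ ↦ 𝓕 K (-ξ)`. -/
def reflectedOp (K : FundamentalKernel N) (φ : 𝓢(Euc N, ℂ)) : Euc N → ℂ :=
  fourierMult (fun ξ => K.symbol (-ξ)) φ

lemma symbol_neg_mem (K : FundamentalKernel N) :
    AEStronglyMeasurable (fun ξ => K.symbol (-ξ)) volume ∧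
      ∀ᵐ ξ : Euc N, ‖K.symbol (-ξ)‖ ≤ ‖K.symbol‖ := by
  have hq : Measure.QuasiMeasurePreserving (fun ξ : Euc N => -ξ) volume volume :=
    (Measure.measurePreserving_neg volume).quasiMeasurePreserving
  refine ⟨(Lp.aestronglyMeasurable K.symbol).comp_quasiMeasurePreserving hq, ?_⟩
  have h : ∀ᵐ ξ : Euc N, ‖K.symbol ξ‖ ≤ ‖K.symbol‖ := by
    filter_upwards [enorm_ae_le_eLpNormEssSup K.symbol volume] with ξ hξ
    rw [Lp.norm_def, eLpNorm_exponent_top, ← toReal_enorm]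
    exact ENNReal.toReal_mono (by simpa using Lp.eLpNorm_ne_top K.symbol) hξ
  exact hq.ae h

lemma integrable_char_symbol_mul (K : FundamentalKernel N) (φ : 𝓢(Euc N, ℂ)) (x : Euc N) :
    Integrable (fun ξ => Real.fourierChar (inner ℝ ξ x) • (K.symbol (-ξ) * 𝓕 φ ξ)) := by
  obtain ⟨h1, h2⟩ := K.symbol_neg_mem
  have h : Integrable (fun ξ => K.symbol (-ξ) * 𝓕 φ ξ) := (𝓕 φ).integrable.bdd_mul h1 h2
  simpa using (Real.fourierIntegral_convergent_iff (-x)).2 h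

lemma reflectedOp_apply (K : FundamentalKernel N) (φ : 𝓢(Euc N, ℂ)) (x : Euc N) :
    K.reflectedOp φ x =
      ∫ ξ, Real.fourierChar (inner ℝ ξ x) • (K.symbol (-ξ) * 𝓕 φ ξ) :=
  Real.fourierInv_eq _ _

lemma norm_reflectedOp_le (K : FundamentalKernel N) (φ : 𝓢(Euc N, ℂ)) (x : Euc N) :
    ‖K.reflectedOp φ x‖ ≤ ‖K.symbol‖ * ‖(𝓕 φ).toLp 1 (volume : Measure (Euc N))‖ := by
  obtain ⟨-, h2⟩ := K.symbol_neg_mem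
  rw [SchwartzMap.norm_toLp_one, ← integral_const_mul, reflectedOp_apply]
  refine norm_integral_le_of_norm_le ((𝓕 φ).integrable.norm.const_mul _) ?_
  filter_upwards [h2] with ξ hξ
  rw [Circle.norm_smul, norm_mul]
  gcongr

lemma continuous_reflectedOp (K : FundamentalKernel N) (φ : 𝓢(Euc N, ℂ)) :
    Continuous (K.reflectedOp φ) := by
  obtain ⟨h1, h2⟩ := K.symbol_neg_mem
  rw [funext (K.reflectedOp_apply φ)]
  refine continuous_of_dominated (fun x => (K.integrable_char_symbol_mul φ x).1)
    (bound := fun ξ => ‖K.symbol‖ * ‖𝓕 φ ξ‖) (fun x => ?_)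
    ((𝓕 φ).integrable.norm.const_mul _) (ae_of_all _ fun ξ => ?_)
  · filter_upwards [h2] with ξ hξ
    rw [Circle.norm_smul, norm_mul]
    gcongr
  · have := Real.continuous_fourierChar
    fun_prop

lemma integrable_reflectedOp (K : FundamentalKernel N) (φ : 𝓢(Euc N, ℂ))
    (μ : Measure (Euc N)) [IsFiniteMeasure μ] : Integrable (K.reflectedOp φ) μ :=
  Integrable.of_bound (K.continuous_reflectedOp φ).aestronglyMeasurable _
    (ae_of_all _ (K.norm_reflectedOp_le φ))

lemma reflectedOp_add (K : FundamentalKernel N) (φ ψ : 𝓢(Euc N, ℂ)) :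
    K.reflectedOp (φ + ψ) = K.reflectedOp φ + K.reflectedOp ψ := by
  funext x
  rw [Pi.add_apply, reflectedOp_apply, reflectedOp_apply, reflectedOp_apply,
    ← integral_add (K.integrable_char_symbol_mul φ x) (K.integrable_char_symbol_mul ψ x)]
  refine integral_congr_ae (ae_of_all _ fun ξ => ?_)
  have : (𝓕 (φ + ψ)) ξ = 𝓕 φ ξ + 𝓕 ψ ξ := by
    rw [FourierTransform.fourier_add]; rfl
  simp only [this, mul_add, smul_add]

lemma reflectedOp_smul (K : FundamentalKernel N) (c : ℂ) (φ : 𝓢(Euc N, ℂ)) :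
    K.reflectedOp (c • φ) = c • K.reflectedOp φ := by
  funext x
  rw [Pi.smul_apply, reflectedOp_apply, reflectedOp_apply, ← integral_smul]
  refine integral_congr_ae (ae_of_all _ fun ξ => ?_)
  have : (𝓕 (c • φ)) ξ = c * 𝓕 φ ξ := by
    rw [FourierTransform.fourier_smul]; rfl
  simp only [this, Circle.smul_def, smul_eq_mul]
  ring

/-- `φ ↦ ∫ S̃ φ dμ` for a positive finite measure `μ`, as a tempered distribution. -/
def pairing (K : FundamentalKernel N) (μ : Measure (Euc N)) [IsFiniteMeasure μ] :
    𝓢'(Euc N, ℂ) :=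
  ContinuousLinearMap.toPointwiseConvergenceCLM _ _ _ _
    { toFun := fun φ => ∫ x, K.reflectedOp φ x ∂μ
      map_add' := fun φ ψ => by
        rw [K.reflectedOp_add]
        exact integral_add (K.integrable_reflectedOp φ μ) (K.integrable_reflectedOp ψ μ)
      map_smul' := fun c φ => by
        rw [K.reflectedOp_smul]
        exact integral_smul c _
      cont := by
        let l : 𝓢(Euc N, ℂ) →+ ℂ :=
          AddMonoidHom.mk' (fun φ => ∫ x, K.reflectedOp φ x ∂μ) fun φ ψ => by
            rw [K.reflectedOp_add]
            exact integral_add (K.integrable_reflectedOp φ μ) (K.integrable_reflectedOp ψ μ)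
        refine continuous_of_continuousAt_zero l ?_
        have hc : Continuous fun φ : 𝓢(Euc N, ℂ) =>
            ‖K.symbol‖ * ‖(𝓕 φ).toLp 1 (volume : Measure (Euc N))‖ * μ.real univ :=
          ((SchwartzMap.continuous_toLp.comp
            (FourierTransform.continuous_fourier)).norm.const_mul _).mul_const _
        have h0 := hc.tendsto 0
        have hz : (𝓕 (0 : 𝓢(Euc N, ℂ))).toLp 1 (volume : Measure (Euc N)) = 0 := by
          rw [FourierTransform.fourier_zero]
          exact map_zero (SchwartzMap.toLpCLM ℂ ℂ 1 (volume : Measure (Euc N)))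
        rw [hz, norm_zero, mul_zero, zero_mul] at h0
        rw [ContinuousAt, map_zero]
        exact squeeze_zero_norm
          (fun φ => norm_integral_le_of_norm_le_const (ae_of_all _ (K.norm_reflectedOp_le φ))) h0 }

/-- The singular integral operator associated to `K`, applied to a finite measure `g`: the tempered
distribution `S g` defined by `⟨S g, φ⟩ = ∫ S̃ φ dg` for all Schwartz functions `φ`. -/
def apply (K : FundamentalKernel N) (g : SignedMeasure (Euc N)) : 𝓢'(Euc N, ℂ) :=
  K.pairing g.toJordanDecomposition.posPart - K.pairing g.toJordanDecomposition.negPart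

/-- The defining formula of `S g`. -/
lemma apply_eq (K : FundamentalKernel N) (g : SignedMeasure (Euc N)) (φ : 𝓢(Euc N, ℂ)) :
    K.apply g φ = integralSigned (K.reflectedOp φ) g := rfl

end FundamentalKernel

/-! ### Maximal functions relative to a family of kernels -/

/-- The Schwartz function `y ↦ ρ_ε(x - y)`, where `ρ_ε(z) = ε^{-N} ρ(z / ε)`. -/
def dilatedAt {N : ℕ} (ρ : 𝓓((⊤ : TopologicalSpace.Opens (Euc N)), ℝ)) (ε : Ioi (0 : ℝ))
    (x : Euc N) : 𝓢(Euc N, ℂ) :=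
  HasCompactSupport.toSchwartzMap
    (f := fun y => (((ε : ℝ) ^ N)⁻¹ * ρ ((ε : ℝ)⁻¹ • (x - y)) : ℝ))
    (by
      have hε : (ε : ℝ)⁻¹ ≠ 0 := inv_ne_zero (ne_of_gt ε.2)
      let e : Euc N ≃ₜ Euc N := (Homeomorph.subLeft x).trans (Homeomorph.smulOfNeZero _ hε)
      have h : HasCompactSupport fun y => ρ ((ε : ℝ)⁻¹ • (x - y)) :=
        ρ.hasCompactSupport.comp_homeomorph e
      exact (h.mul_left (f := fun _ => ((ε : ℝ) ^ N)⁻¹)).comp_left Complex.ofReal_zero)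
    (by
      have h : ContDiff ℝ ∞ ρ := ρ.contDiff
      exact Complex.ofRealCLM.contDiff.comp
        (contDiff_const.mul (h.comp ((contDiff_const.sub contDiff_id).const_smul _))))

/-- The `{ρ^ν}`-maximal function of a (tempered) distribution `T`,
`M_{ρ^ν}(T)(x) = sup_ν sup_{ε > 0} |⟨T, ρ^ν_ε(x - ·)⟩|`, with values in `[0, ∞]`. -/
def maximalFunction {N : ℕ} {ι : Type*} (ρ : ι → 𝓓((⊤ : TopologicalSpace.Opens (Euc N)), ℝ))
    (T : 𝓢'(Euc N, ℂ)) (x : Euc N) : ℝ≥0∞ :=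
  ⨆ (ν : ι) (ε : Ioi (0 : ℝ)), ‖T (dilatedAt (ρ ν) ε x)‖ₑ

/-- The kernels `Υ^{ξ,j}(w) = h(ξ/2 - w) w_j`. -/
def upsilon {N : ℕ} (h : 𝓓((⊤ : TopologicalSpace.Opens (Euc N)), ℝ)) (j : Fin N)
    (ξ : Metric.sphere (0 : Euc N) 1) : 𝓓((⊤ : TopologicalSpace.Opens (Euc N)), ℝ) where
  toFun w := h ((1 / 2 : ℝ) • (ξ : Euc N) - w) * w j
  contDiff' := by
    have hh : ContDiff ℝ ∞ h := h.contDiff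
    exact (hh.comp (contDiff_const.sub contDiff_id)).mul (by fun_prop)
  hasCompactSupport' :=
    (h.hasCompactSupport.comp_homeomorph (Homeomorph.subLeft ((1 / 2 : ℝ) • (ξ : Euc N)))).mul_right
  tsupport_subset' := fun _ _ => trivial

/-- The explicit function `U = ∑_{j,k} M_{{Υ^{ξ,j} : ξ ∈ S^{N-1}}}(S_{jk} g_{jk})`. -/
def explicitU {N m : ℕ} (h : 𝓓((⊤ : TopologicalSpace.Opens (Euc N)), ℝ))
    (S : Fin N → Fin m → FundamentalKernel N) (g : Fin N → Fin m → SignedMeasure (Euc N))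
    (x : Euc N) : ℝ≥0∞ :=
  ∑ j, ∑ k, maximalFunction (upsilon h j) ((S j k).apply (g j k)) x

/-! ### Distributional derivatives -/

/-- `∂_j u = T` in the sense of distributions: `-∫ u ∂_jφ = ⟨T, φ⟩` for all `φ ∈ C^∞_c(ℝ^N)`
(the compactly supported Schwartz functions). -/
def HasDistribPartial {N : ℕ} (u : Euc N → ℝ) (j : Fin N) (T : 𝓢'(Euc N, ℂ)) : Prop :=
  ∀ φ : 𝓢(Euc N, ℂ), HasCompactSupport φ →
    -∫ x, (u x : ℂ) * fderiv ℝ φ x (EuclideanSpace.single j 1) = T φ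

end DiffQuot
end

/-!
The proof has two independent parts.

*The pointwise estimate.* For a unit vector `ξ` let `F(ε)` be the integral of `u` against the
mollifier `h`, scaled by `ε` and centred at `x - ε ξ / 2` (`shiftedBump`). The derivative of this
kernel with respect to `ε` is the divergence of the vector field with components
`Υ^{ξ,j}_ε(x - ·)` (`sum_fderiv_dilatedAt_upsilon`), so `F'(ε)` is, up to the sign, the pairing of
the distributional gradient of `u` with this field, and `|F'| ≤ U(x)`. Since `F(ε) → u(x)` as
`ε → 0` whenever `x` is a Lebesgue point, `|F(r) - u(x)| ≤ r U(x)`. For `r = |x - y|` the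
mollifications attached to `x` with `ξ = (x - y) / r` and to `y` with `-ξ` are both centred at the
midpoint of `x` and `y`, so they coincide, and the triangle inequality gives the claim.

*The weak type bound for `U`.* Pairing `S g` with `ρ_ε(x - ·)` amounts to convolving `g` with the
function `Φ = K * ρ_ε` (`reflectedOp_dilatedAt`, `apply_dilatedAt`). Uniformly in `ε` and in the
family, `|Φ(z) - Φ(w)| ≤ C |z - w| / |z|^{N+1}` for `2 |z - w| ≤ |z|`: if `ε` is at least comparable
to `|z|` this follows from the boundedness of the symbol and of the first moment of the Fourier
transform of `ρ`, and if `ε` is small from the gradient bound of `K` away from the origin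
(`exists_regularity`). On bounded integrable densities `S` is represented by a bounded operator of
`L²`, whose values have a Hardy–Littlewood maximal function dominating the maximal function in
question (`exists_weak_type_two`). A Calderón–Zygmund argument for the supremum of all these kernels
then gives the weak type `(1,1)` bound on finite measures (`exists_weak_type_maximal`). The
decomposition is stopped at cells of a small size `η`, so that the good part is always a bounded
density even if the measure is singular; on the cells of size `η` which were not selected the
kernels hardly vary, provided that they are Lipschitz with a constant that is small relative to
`1 / η`, and the resulting restriction on the kernels is removed by letting `η → 0`. The kernels
`Υ^{ξ,j}` satisfy the hypotheses uniformly in `ξ`, being combinations, with bounded coefficients, of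
translates of the reflections of two fixed functions (`norm_fourier_upsilon_le`).
-/

noncomputable section

namespace DiffQuot

variable {N : ℕ}

/-! ### The Hardy–Littlewood maximal inequality -/

/-- The weak type `(1,1)` bound for the Hardy–Littlewood maximal function of a measure `μ`, by
Vitali's covering lemma. -/
theorem mul_volume_exists_closedBall_lt_le {N : ℕ} (μ : Measure (Euc N)) (t : ℝ≥0∞) :
    t * volume {x : Euc N | ∃ r : ℝ, 0 < r ∧
      t * volume (Metric.closedBall x r) < μ (Metric.closedBall x r)} ≤
      ENNReal.ofReal (5 ^ N) * μ univ := by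
  -- Vitali's lemma needs bounded radii; the bound is removed by monotone convergence.
  set A : ℕ → Set (Euc N) := fun n => {x : Euc N | ∃ r : ℝ, (0 < r ∧ r ≤ n) ∧
      t * volume (Metric.closedBall x r) < μ (Metric.closedBall x r)} with hA
  have hmono : Monotone A := by
    rintro a b hab x ⟨r, ⟨h0, h1⟩, h2⟩
    exact ⟨r, ⟨h0, h1.trans (by exact_mod_cast hab)⟩, h2⟩
  have hU : {x : Euc N | ∃ r : ℝ, 0 < r ∧
      t * volume (Metric.closedBall x r) < μ (Metric.closedBall x r)} = ⋃ n, A n := by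
    ext x
    simp only [hA, mem_ofPred_eq, mem_iUnion]
    constructor
    · rintro ⟨r, h0, h1⟩
      obtain ⟨n, hn⟩ := exists_nat_ge r
      exact ⟨n, r, ⟨h0, hn⟩, h1⟩
    · rintro ⟨n, r, ⟨h0, -⟩, h1⟩
      exact ⟨r, h0, h1⟩
  rw [hU, hmono.measure_iUnion, ENNReal.mul_iSup]
  refine iSup_le fun n => ?_
  obtain ⟨u, hut, hdisj, hcov⟩ := Vitali.exists_disjoint_subfamily_covering_enlargement_closedBall
    {p : Euc N × ℝ | (0 < p.2 ∧ p.2 ≤ n) ∧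
      t * volume (Metric.closedBall p.1 p.2) < μ (Metric.closedBall p.1 p.2)}
    Prod.fst Prod.snd n (fun a ha => ha.1.2) 5 (by norm_num)
  have hucount : u.Countable := hdisj.countable_of_nonempty_interior fun p hp =>
    ⟨p.1, Metric.ball_subset_interior_closedBall (Metric.mem_ball_self (hut hp).1.1)⟩
  have : Countable u := hucount.to_subtype
  have hsub : A n ⊆ ⋃ p : u, Metric.closedBall p.1.1 (5 * p.1.2) := by
    rintro x ⟨r, hr, hx⟩
    obtain ⟨b, hb, hb2⟩ := hcov (x, r) ⟨hr, hx⟩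
    exact mem_iUnion.2 ⟨⟨b, hb⟩, hb2 (Metric.mem_closedBall_self hr.1.le)⟩
  calc t * volume (A n) ≤ t * ∑' p : u, volume (Metric.closedBall p.1.1 (5 * p.1.2)) := by
        gcongr
        exact (measure_mono hsub).trans (measure_iUnion_le _)
    _ = ENNReal.ofReal (5 ^ N) * ∑' p : u, t * volume (Metric.closedBall p.1.1 p.1.2) := by
        rw [← ENNReal.tsum_mul_left, ← ENNReal.tsum_mul_left]
        congr 1 with p
        have h := Measure.addHaar_closedBall_mul volume p.1.1 (r := 5) (by norm_num)
          (hut p.2).1.1.le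
        rw [h, Measure.addHaar_closedBall_center volume p.1.1 p.1.2]
        simp only [finrank_euclideanSpace, Fintype.card_fin]
        ring
    _ ≤ ENNReal.ofReal (5 ^ N) * ∑' p : u, μ (Metric.closedBall p.1.1 p.1.2) := by
        gcongr with p
        exact (hut p.2).2.le
    _ = ENNReal.ofReal (5 ^ N) * μ (⋃ p : u, Metric.closedBall p.1.1 p.1.2) := by
        rw [measure_iUnion _ fun p => Metric.isClosed_closedBall.measurableSet]
        intro a b hab
        exact hdisj a.2 b.2 fun h => hab (Subtype.ext h)
    _ ≤ _ := by gcongr; exact subset_univ _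

/-! ### Dyadic cells -/

/-- The index of the dyadic cell of side `s / 2 ^ n` that contains `x`. -/
def gridIndex {N : ℕ} (s : ℝ) (n : ℕ) (x : Euc N) : Fin N → ℤ := fun i => ⌊2 ^ n * (x i / s)⌋

/-- The dyadic cell of side `s / 2 ^ n` with index `k`. -/
def gridCell {N : ℕ} (s : ℝ) (n : ℕ) (k : Fin N → ℤ) : Set (Euc N) := gridIndex s n ⁻¹' {k}

lemma measurableSet_gridCell (s : ℝ) (n : ℕ) (k : Fin N → ℤ) :
    MeasurableSet (gridCell s n k) := by
  have : Measurable (gridIndex (N := N) s n) := by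
    refine measurable_pi_lambda _ fun i => ?_
    unfold gridIndex
    fun_prop
  exact this (measurableSet_singleton k)

lemma gridIndex_eq_of_le {s : ℝ} {m n : ℕ} (hmn : m ≤ n) {x y : Euc N}
    (h : gridIndex s n x = gridIndex s n y) : gridIndex s m x = gridIndex s m y := by
  have key : ∀ (z : Euc N) (i : Fin N), gridIndex s m z i = gridIndex s n z i / (2 ^ (n - m) : ℕ) := by
    intro z i
    unfold gridIndex
    rw [← Int.floor_div_natCast]
    congr 1
    push_cast
    have : (2 : ℝ) ^ n = 2 ^ m * 2 ^ (n - m) := by rw [← pow_add, Nat.add_sub_cancel' hmn]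
    rw [this]
    field_simp
  ext i
  rw [key, key, h]

lemma volume_gridCell {s : ℝ} (hs : 0 < s) (n : ℕ) (k : Fin N → ℤ) :
    volume (gridCell s n k) = ENNReal.ofReal ((s / 2 ^ n) ^ N) := by
  have hset : gridCell s n k = (fun x : Euc N => WithLp.ofLp x) ⁻¹' (Set.pi univ fun i =>
      Ico ((k i : ℝ) * (s / 2 ^ n)) (((k i : ℝ) + 1) * (s / 2 ^ n))) := by
    ext x
    simp only [gridCell, mem_preimage, mem_singleton_iff, Set.mem_pi, mem_univ, true_imp_iff,
      funext_iff, gridIndex, Int.floor_eq_iff, mem_Ico]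
    refine forall_congr' fun i => ?_
    have e : (2 : ℝ) ^ n * (x i / s) = x i / (s / 2 ^ n) := by field_simp
    have hp : 0 < s / 2 ^ n := by positivity
    rw [e, le_div_iff₀ hp, div_lt_iff₀ hp]
  rw [hset, (PiLp.volume_preserving_ofLp (Fin N)).measure_preimage
    (MeasurableSet.univ_pi fun i => measurableSet_Ico).nullMeasurableSet, Real.volume_pi_Ico]
  have : ∀ i : Fin N, ((k i : ℝ) + 1) * (s / 2 ^ n) - k i * (s / 2 ^ n) = s / 2 ^ n := by
    intro i; ring
  simp only [this, Finset.prod_const, Finset.card_univ, Fintype.card_fin]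
  rw [ENNReal.ofReal_pow (by positivity)]

lemma norm_sub_le_of_gridIndex_eq {s : ℝ} (hs : 0 < s) {n : ℕ} {x y : Euc N}
    (h : gridIndex s n x = gridIndex s n y) : ‖x - y‖ ≤ (N + 1) * (s / 2 ^ n) := by
  have hp : 0 < s / 2 ^ n := by positivity
  have hi : ∀ i, |x i - y i| ≤ s / 2 ^ n := by
    intro i
    have h1 := Int.abs_sub_lt_one_of_floor_eq_floor (congrFun h i)
    have e : (2 : ℝ) ^ n * (x i / s) - 2 ^ n * (y i / s) = (x i - y i) / (s / 2 ^ n) := by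
      field_simp
    rw [e, abs_div, abs_of_pos hp, div_lt_one hp] at h1
    exact h1.le
  rw [EuclideanSpace.norm_eq]
  have : ∑ i, ‖(x - y) i‖ ^ 2 ≤ ∑ _i : Fin N, (s / 2 ^ n) ^ 2 := by
    refine Finset.sum_le_sum fun i _ => ?_
    have := hi i
    rw [PiLp.sub_apply, Real.norm_eq_abs]
    gcongr
  refine Real.sqrt_le_iff.2 ⟨by positivity, this.trans ?_⟩
  rw [Finset.sum_const, Finset.card_univ, Fintype.card_fin, nsmul_eq_mul, mul_pow]
  gcongr
  nlinarith [(Nat.cast_nonneg N : (0 : ℝ) ≤ N)]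

/-! ### The Calderón–Zygmund decomposition -/

/-- Replacing a measure by its averages over the fibres of a countable partition `π` preserves the
mass of every fibre. -/
lemma map_withDensity_average {α ι : Type*} [MeasurableSpace α] [MeasurableSpace ι] [Countable ι]
    [MeasurableSingletonClass ι] {μ ν : Measure α} {π : α → ι} (hπ : Measurable π)
    (h0 : ∀ x, ν (π ⁻¹' {π x}) ≠ 0) (h1 : ∀ x, ν (π ⁻¹' {π x}) ≠ ⊤) :
    (ν.withDensity fun x => μ (π ⁻¹' {π x}) / ν (π ⁻¹' {π x})).map π = μ.map π := by
  refine Measure.ext_of_singleton fun i => ?_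
  have hm : MeasurableSet (π ⁻¹' {i}) := hπ (measurableSet_singleton i)
  rw [Measure.map_apply hπ (measurableSet_singleton i),
    Measure.map_apply hπ (measurableSet_singleton i), withDensity_apply _ hm]
  rcases (π ⁻¹' {i}).eq_empty_or_nonempty with he | ⟨x, rfl⟩
  · simp [he]
  · have : ∫⁻ y in π ⁻¹' {π x}, μ (π ⁻¹' {π y}) / ν (π ⁻¹' {π y}) ∂ν =
        ∫⁻ y in π ⁻¹' {π x}, μ (π ⁻¹' {π x}) / ν (π ⁻¹' {π x}) ∂ν := by
      refine setLIntegral_congr_fun hm fun y hy => ?_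
      have hy' : π y = π x := hy
      simp only [hy']
    rw [this, setLIntegral_const, ENNReal.div_mul_cancel (h0 x) (h1 x)]

/-- The Calderón–Zygmund decomposition of a finite measure `μ` at height `lam`: a countable
partition `π` of the space into cells of size `d`, and a function `g ≤ 2 ^ N * lam` which gives
every cell the same mass as `μ`. On a cell outside the set `B` of bad cells, `d` is at most the
prescribed mesh `η`; the bad cells have small total volume, as `μ` has average above `lam` there. -/
theorem exists_calderonZygmund_decomposition (hN : N ≠ 0) (μ : Measure (Euc N))
    [IsFiniteMeasure μ] {lam : ℝ≥0∞} (h0 : lam ≠ 0) (h1 : lam ≠ ⊤) {η : ℝ} (hη : 0 < η) :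
    ∃ (π : Euc N → ℕ × (Fin N → ℤ)) (g : Euc N → ℝ≥0∞) (c : ℕ × (Fin N → ℤ) → Euc N)
      (d : ℕ × (Fin N → ℤ) → ℝ) (B : Set (ℕ × (Fin N → ℤ))),
      Measurable π ∧ Measurable g ∧ (∀ x, g x ≤ 2 ^ N * lam) ∧
      (volume.withDensity g).map π = μ.map π ∧ (∀ i, 0 < d i) ∧
      (∀ y, ‖y - c (π y)‖ ≤ d (π y)) ∧ (∀ y, π y ∉ B → d (π y) ≤ η) ∧
      ∀ i ∈ B, lam * ENNReal.ofReal (d i ^ N) ≤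
        ENNReal.ofReal ((N + 1) ^ N) * μ (π ⁻¹' {i}) := by
  classical
  -- The side `s` of the largest cells is such that `μ` has average at most `lam` on them.
  obtain ⟨s, hs, hsμ⟩ : ∃ s : ℝ, 0 < s ∧ μ univ ≤ lam * ENNReal.ofReal (s ^ N) := by
    have hfin : μ univ / lam ≠ ⊤ := ENNReal.div_ne_top (measure_ne_top μ _) h0
    refine ⟨max 1 (μ univ / lam).toReal, by positivity, ?_⟩
    calc μ univ = lam * (μ univ / lam) := (ENNReal.mul_div_cancel h0 h1).symm
      _ = lam * ENNReal.ofReal (μ univ / lam).toReal := by rw [ENNReal.ofReal_toReal hfin]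
      _ ≤ _ := by
        gcongr
        exact (le_max_right _ _).trans (le_self_pow₀ (le_max_left _ _) hN)
  -- The smallest cells have level `n`.
  obtain ⟨n, hn⟩ : ∃ n : ℕ, (N + 1) * (s / 2 ^ n) ≤ η := by
    have h : Tendsto (fun n : ℕ => (N + 1) * s * (1 / 2 : ℝ) ^ n) atTop (𝓝 ((N + 1) * s * 0)) :=
      (tendsto_pow_atTop_nhds_zero_of_lt_one (by norm_num) (by norm_num)).const_mul _
    rw [mul_zero] at h
    obtain ⟨n, hn⟩ := (h.eventually (ge_mem_nhds hη)).exists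
    refine ⟨n, le_trans (le_of_eq ?_) hn⟩
    rw [one_div, inv_pow]
    ring
  set heavy : ℕ → (Fin N → ℤ) → Prop := fun i k =>
    lam * volume (gridCell s i k) < μ (gridCell s i k) with hheavy
  have hex : ∀ x : Euc N, ∃ i, i = n ∨ heavy i (gridIndex s i x) := fun x => ⟨n, Or.inl rfl⟩
  set τ : Euc N → ℕ := fun x => Nat.find (hex x) with hτ
  set π : Euc N → ℕ × (Fin N → ℤ) := fun x => (τ x, gridIndex s (τ x) x) with hπdef
  have hτeq : ∀ x y, gridIndex s (τ x) y = gridIndex s (τ x) x → τ y = τ x := by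
    intro x y hxy
    have hle : ∀ m ≤ τ x, gridIndex s m y = gridIndex s m x := fun m hm =>
      gridIndex_eq_of_le hm hxy
    refine (Nat.find_eq_iff (hex y)).2 ⟨?_, fun m hm => ?_⟩
    · rw [hxy]; exact Nat.find_spec (hex x)
    · rw [hle m hm.le]; exact Nat.find_min (hex x) hm
  have hfib : ∀ x, π ⁻¹' {π x} = gridCell s (τ x) (gridIndex s (τ x) x) := by
    intro x
    ext y
    simp only [mem_preimage, mem_singleton_iff, hπdef, Prod.mk.injEq, gridCell]
    constructor
    · rintro ⟨ha, hb⟩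
      rwa [ha] at hb
    · intro hy
      have := hτeq x y hy
      exact ⟨this, by rw [this, hy]⟩
  have hπ : Measurable π := by
    refine measurable_to_countable' fun i => ?_
    rcases (π ⁻¹' {i}).eq_empty_or_nonempty with he | ⟨x, rfl⟩
    · rw [he]; exact MeasurableSet.empty
    · rw [hfib]; exact measurableSet_gridCell _ _ _
  have hvol : ∀ x, volume (π ⁻¹' {π x}) = ENNReal.ofReal ((s / 2 ^ τ x) ^ N) := fun x => by
    rw [hfib, volume_gridCell hs]
  have hv0 : ∀ x, volume (π ⁻¹' {π x}) ≠ 0 := fun x => by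
    rw [hvol]
    have : 0 < (s / 2 ^ τ x) ^ N := by positivity
    exact (ENNReal.ofReal_pos.2 this).ne'
  have hv1 : ∀ x, volume (π ⁻¹' {π x}) ≠ ⊤ := fun x => by
    rw [hvol]; exact ENNReal.ofReal_ne_top
  have hc : ∀ i, ∃ c : Euc N, ∀ y, π y = i → π c = i := fun i => by
    by_cases h : ∃ y, π y = i
    · obtain ⟨y, hy⟩ := h
      exact ⟨y, fun _ _ => hy⟩
    · exact ⟨0, fun y hy => (h ⟨y, hy⟩).elim⟩
  choose c hc using hc
  refine ⟨π, fun x => μ (π ⁻¹' {π x}) / volume (π ⁻¹' {π x}), c,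
    fun i => (N + 1) * (s / 2 ^ i.1), {i | lam * ENNReal.ofReal ((s / 2 ^ i.1) ^ N) < μ (π ⁻¹' {i})},
    hπ, (measurable_of_countable fun i => μ (π ⁻¹' {i}) / volume (π ⁻¹' {i})).comp hπ, ?_,
    map_withDensity_average hπ hv0 hv1, fun i => by positivity, ?_, ?_, ?_⟩
  · intro x
    refine ENNReal.div_le_of_le_mul ?_
    rw [hvol, hfib]
    rcases hm : τ x with _ | m
    · calc _ ≤ μ univ := measure_mono (subset_univ _)
        _ ≤ lam * ENNReal.ofReal (s ^ N) := hsμ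
        _ ≤ 2 ^ N * lam * ENNReal.ofReal ((s / 2 ^ 0) ^ N) := by
          rw [pow_zero, div_one, mul_assoc]
          exact le_mul_of_one_le_left' (one_le_pow₀ one_le_two)
    · have h := Nat.find_min (hex x) (m := m) (by change m < τ x; omega)
      have h2 : μ (gridCell s m (gridIndex s m x)) ≤ lam * volume (gridCell s m (gridIndex s m x)) :=
        not_lt.1 fun h3 => h (Or.inr h3)
      rw [volume_gridCell hs] at h2
      calc _ ≤ μ (gridCell s m (gridIndex s m x)) :=
            measure_mono fun y hy => gridIndex_eq_of_le (Nat.le_succ m) hy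
        _ ≤ lam * ENNReal.ofReal ((s / 2 ^ m) ^ N) := h2
        _ = 2 ^ N * lam * ENNReal.ofReal ((s / 2 ^ (m + 1)) ^ N) := by
          have e : (s / 2 ^ m) ^ N = 2 ^ N * (s / 2 ^ (m + 1)) ^ N := by
            rw [← mul_pow, pow_succ]; congr 1; field_simp
          rw [e, ENNReal.ofReal_mul (by positivity), ENNReal.ofReal_pow (by norm_num)]
          rw [ENNReal.ofReal_ofNat]
          ring
  · intro y
    have h : π (c (π y)) = π y := hc (π y) y rfl
    refine norm_sub_le_of_gridIndex_eq hs ?_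
    have h1 : τ (c (π y)) = τ y := congrArg Prod.fst h
    have h2 : gridIndex s (τ (c (π y))) (c (π y)) = gridIndex s (τ y) y := congrArg Prod.snd h
    rw [h1] at h2
    exact h2.symm
  · intro y hy
    rcases Nat.find_spec (hex y) with h | h
    · change (N + 1) * (s / 2 ^ τ y) ≤ η
      rw [show τ y = n from h]
      exact hn
    · refine (hy ?_).elim
      change lam * ENNReal.ofReal ((s / 2 ^ τ y) ^ N) < μ (π ⁻¹' {π y})
      rw [← hvol, hfib]
      exact h
  · intro i hi
    rw [mul_pow, ENNReal.ofReal_mul (by positivity), mul_left_comm]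
    gcongr
    exact le_of_lt hi

/-! ### Maximal functions of Calderón–Zygmund type -/

/-- The mass of the tail `d / (d + ‖z‖) ^ (N + 1)` does not depend on the scale `d`. -/
lemma exists_lintegral_tail_le (N : ℕ) : ∃ Q : ℝ≥0∞, Q ≠ ⊤ ∧ ∀ (d : ℝ) (c : Euc N), 0 < d →
    ∫⁻ z, ENNReal.ofReal (d / (d + ‖z - c‖) ^ (N + 1)) ≤ Q := by
  have hfin := finite_integral_one_add_norm (μ := (volume : Measure (Euc N)))
    (r := (N : ℝ) + 1) (by simp)
  refine ⟨_, hfin.ne, fun d c hd => ?_⟩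
  rw [lintegral_sub_right_eq_self (μ := volume)
    (fun z : Euc N => ENNReal.ofReal (d / (d + ‖z‖) ^ (N + 1))) c]
  set f : Euc N → ℝ≥0∞ := fun z => ENNReal.ofReal ((1 + ‖z‖) ^ (-((N : ℝ) + 1))) with hf
  have hfm : Measurable f := by fun_prop
  have h1 : ∀ z : Euc N, ENNReal.ofReal (d / (d + ‖z‖) ^ (N + 1)) =
      ENNReal.ofReal ((d ^ N)⁻¹) * f (d⁻¹ • z) := by
    intro z
    rw [hf, ← ENNReal.ofReal_mul (by positivity)]
    congr 1
    have e : (-((N : ℝ) + 1)) = -((N + 1 : ℕ) : ℝ) := by push_cast; ring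
    rw [e, Real.rpow_neg (by positivity), Real.rpow_natCast, norm_smul, norm_inv,
      Real.norm_of_nonneg hd.le]
    have : d + ‖z‖ = d * (1 + d⁻¹ * ‖z‖) := by field_simp
    rw [this, mul_pow, pow_succ d]
    field_simp
  simp_rw [h1]
  rw [lintegral_const_mul _ (by fun_prop), ← lintegral_map hfm (by fun_prop),
    Measure.map_addHaar_smul _ (inv_ne_zero hd.ne'), lintegral_smul_measure, smul_eq_mul,
    ← mul_assoc, ← ENNReal.ofReal_mul (by positivity)]
  simp only [finrank_euclideanSpace, Fintype.card_fin]
  rw [abs_of_pos (by positivity), inv_pow, inv_inv, inv_mul_cancel₀ (by positivity),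
    ENNReal.ofReal_one, one_mul]

/-- Two finite measures which give every fibre of a countable partition `π` the same mass have
almost the same integrals of a function which oscillates little on the fibres. -/
lemma enorm_integral_le_of_map_eq {α ι : Type*} [MeasurableSpace α] [MeasurableSpace ι]
    [Countable ι] [MeasurableSingletonClass ι] {μ ν : Measure α} [IsFiniteMeasure μ]
    [IsFiniteMeasure ν] {π : α → ι} (hπ : Measurable π) (hμν : ν.map π = μ.map π)
    {f : α → ℂ} (hf : Measurable f) {M : ℝ} (hM : ∀ x, ‖f x‖ ≤ M) (c : ι → α)
    {D : ι → ℝ≥0∞} (hD : ∀ x, ‖f x - f (c (π x))‖ₑ ≤ D (π x)) :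
    ‖∫ x, f x ∂μ‖ₑ ≤ ‖∫ x, f x ∂ν‖ₑ + 2 * ∫⁻ x, D (π x) ∂μ := by
  have hm : Measurable fun i => f (c i) := measurable_of_countable _
  have hi : ∀ ρ : Measure α, IsFiniteMeasure ρ → Integrable f ρ := fun ρ _ =>
    Integrable.of_bound hf.aestronglyMeasurable M (ae_of_all _ hM)
  have hi' : ∀ ρ : Measure α, IsFiniteMeasure ρ → Integrable (fun x => f (c (π x))) ρ :=
    fun ρ _ => Integrable.of_bound (hm.comp hπ).aestronglyMeasurable M (ae_of_all _ fun x => hM _)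
  have heq : ∫ x, f (c (π x)) ∂μ = ∫ x, f (c (π x)) ∂ν := by
    rw [← integral_map hπ.aemeasurable (f := fun i => f (c i)) hm.aestronglyMeasurable,
      ← integral_map hπ.aemeasurable (f := fun i => f (c i)) hm.aestronglyMeasurable, hμν]
  have hDeq : ∫⁻ x, D (π x) ∂ν = ∫⁻ x, D (π x) ∂μ := by
    rw [← lintegral_map (measurable_of_countable D) hπ,
      ← lintegral_map (measurable_of_countable D) hπ, hμν]
  have hb : ∀ ρ : Measure α, IsFiniteMeasure ρ →
      ‖∫ x, f x ∂ρ - ∫ x, f (c (π x)) ∂ρ‖ₑ ≤ ∫⁻ x, D (π x) ∂ρ := fun ρ _ => by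
    rw [← integral_sub (hi ρ ‹_›) (hi' ρ ‹_›)]
    exact (enorm_integral_le_lintegral_enorm _).trans (lintegral_mono hD)
  have h1 := hb μ inferInstance
  have h2 := hb ν inferInstance
  rw [hDeq] at h2
  rw [heq] at h1
  set a := ∫ x, f x ∂μ
  set b := ∫ x, f x ∂ν
  set e := ∫ x, f (c (π x)) ∂ν
  calc ‖a‖ₑ = ‖b + ((a - e) - (b - e))‖ₑ := by congr 1; ring
    _ ≤ ‖b‖ₑ + (‖a - e‖ₑ + ‖b - e‖ₑ) :=
      (enorm_add_le _ _).trans (by gcongr; exact enorm_sub_le)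
    _ ≤ _ := by rw [two_mul]; gcongr

/-- The Calderón–Zygmund theorem for maximal functions: if the kernels `P i` satisfy Hörmander's
condition, in its pointwise form and uniformly in `i`, and if the maximal function
`sup i, |P i * g|` satisfies a weak type `(2,2)` bound on bounded densities, then it satisfies a
weak type `(1,1)` bound on finite measures. -/
theorem exists_weak_type_maximal (hN : N ≠ 0) {ι : Type*} {P : ι → Euc N → ℂ}
    (hbdd : ∀ i, ∃ M : ℝ, ∀ z, ‖P i z‖ ≤ M)
    (hlip : ∀ i, ∃ L : ℝ, 0 ≤ L ∧ ∀ z w, ‖P i z - P i w‖ ≤ L * ‖z - w‖)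
    (hreg : ∃ C : ℝ, 0 ≤ C ∧ ∀ i z w, 2 * ‖z - w‖ ≤ ‖z‖ →
      ‖P i z - P i w‖ ≤ C * ‖z - w‖ / ‖z‖ ^ (N + 1))
    (hL2 : ∃ B : ℝ≥0∞, B ≠ ⊤ ∧ ∀ (g : Euc N → ℝ≥0∞) (M : ℝ≥0∞), Measurable g → M ≠ ⊤ →
      (∀ x, g x ≤ M) → ∫⁻ x, g x ≠ ⊤ → ∀ t : ℝ, 0 < t →
      ENNReal.ofReal (t ^ 2) *
        volume {x | ∃ i, t < ‖∫ y, P i (x - y) ∂(volume.withDensity g)‖} ≤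
        B * ∫⁻ x, g x ^ 2) :
    ∃ A : ℝ≥0∞, A ≠ ⊤ ∧ ∀ (μ : Measure (Euc N)) [IsFiniteMeasure μ] (t : ℝ), 0 < t →
      ENNReal.ofReal t * volume {x | ∃ i, t < ‖∫ y, P i (x - y) ∂μ‖} ≤ A * μ univ := by
  obtain ⟨C, hC0, hC⟩ := hreg
  obtain ⟨B, hBtop, hB⟩ := hL2
  obtain ⟨Q, hQtop, hQ⟩ := exists_lintegral_tail_le N
  choose M hM using hbdd
  choose L hL0 hL using hlip
  have hcont : ∀ i, Continuous (P i) := fun i =>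
    (LipschitzWith.of_dist_le_mul (K := (L i).toNNReal) fun z w => by
      rw [dist_eq_norm, dist_eq_norm]
      refine (hL i z w).trans ?_
      gcongr
      exact Real.le_coe_toNNReal _).continuous
  set v : ℝ≥0∞ := volume (Metric.closedBall (0 : Euc N) 1) with hv
  have hvtop : v ≠ ⊤ := measure_closedBall_lt_top.ne
  set A₁ : ℝ≥0∞ := ENNReal.ofReal (2 ^ N) * v * ENNReal.ofReal ((N + 1) ^ N) with hA₁
  set A₂ : ℝ≥0∞ := 2 * (ENNReal.ofReal (C * 2 ^ (N + 1)) * Q) with hA₂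
  set A₃ : ℝ≥0∞ := B * 2 ^ N with hA₃
  have hA₁top : A₁ ≠ ⊤ := by finiteness
  have hA₂top : A₂ ≠ ⊤ := by finiteness
  have hA₃top : A₃ ≠ ⊤ := by finiteness
  refine ⟨4 * (A₁ + A₂ + A₃), by finiteness, fun μ _ t ht => ?_⟩
  -- The height of the decomposition is `t / 4`.
  obtain ⟨T, hT, rfl⟩ : ∃ T : ℝ, 0 < T ∧ t = 4 * T := ⟨t / 4, by positivity, by ring⟩
  set lam : ℝ≥0∞ := ENNReal.ofReal T with hlam
  have hlam0 : lam ≠ 0 := (ENNReal.ofReal_pos.2 hT).ne'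
  have hlamtop : lam ≠ ⊤ := ENNReal.ofReal_ne_top
  -- The kernels in `E n` vary by less than `T` in total on cells of size `1 / (n + 1)`.
  set E : ℕ → Set (Euc N) := fun n => {x | ∃ i,
    2 * (ENNReal.ofReal (L i * (1 / ((n : ℝ) + 1))) * μ univ) ≤ lam ∧
      4 * T < ‖∫ y, P i (x - y) ∂μ‖} with hE
  have hEmono : Monotone E := by
    rintro a b hab x ⟨i, h1, h2⟩
    refine ⟨i, le_trans ?_ h1, h2⟩
    have := hL0 i
    gcongr
  have hEU : {x | ∃ i, 4 * T < ‖∫ y, P i (x - y) ∂μ‖} ⊆ ⋃ n, E n := by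
    rintro x ⟨i, hi⟩
    have h : Tendsto (fun n : ℕ => 2 * (ENNReal.ofReal (L i * (1 / ((n : ℝ) + 1))) * μ univ)) atTop
        (𝓝 (2 * (ENNReal.ofReal (L i * 0) * μ univ))) := by
      refine ENNReal.Tendsto.const_mul (ENNReal.Tendsto.mul_const ?_ (Or.inr (by finiteness)))
        (Or.inr (by finiteness))
      exact ENNReal.tendsto_ofReal (tendsto_one_div_add_atTop_nhds_zero_nat.const_mul _)
    rw [mul_zero, ENNReal.ofReal_zero, zero_mul, mul_zero] at h
    obtain ⟨n, hn⟩ := (h.eventually (ge_mem_nhds (pos_iff_ne_zero.2 hlam0))).exists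
    exact mem_iUnion.2 ⟨n, i, hn, hi⟩
  have key : ∀ n, lam * volume (E n) ≤ (A₁ + A₂ + A₃) * μ univ := by
    intro n
    obtain ⟨π, g, c, d, bad, hπ, hg, hg1, hmap, hd, hcd, hsmall, hbad⟩ :=
      exists_calderonZygmund_decomposition hN μ hlam0 hlamtop
        (η := 1 / ((n : ℝ) + 1)) (by positivity)
    set ν : Measure (Euc N) := volume.withDensity g with hν
    have hνuniv : ν univ = μ univ := by
      have := congrArg (fun m => m univ) hmap
      simpa [Measure.map_apply hπ MeasurableSet.univ] using this
    have hνfin : IsFiniteMeasure ν := ⟨by rw [hνuniv]; exact measure_lt_top _ _⟩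
    have hgint : ∫⁻ x, g x = μ univ := by
      rw [← hνuniv, hν, withDensity_apply _ MeasurableSet.univ, Measure.restrict_univ]
    set Ω : Set (Euc N) := ⋃ i ∈ bad, Metric.closedBall (c i) (2 * d i) with hΩ
    set H : Euc N → ℝ≥0∞ := fun x => ∫⁻ y, ENNReal.ofReal (C * 2 ^ (N + 1)) *
      ENNReal.ofReal (d (π y) / (d (π y) + ‖x - c (π y)‖) ^ (N + 1)) ∂μ with hH
    have hdm : Measurable fun y => d (π y) := (measurable_of_countable d).comp hπ
    have hcm : Measurable fun y => c (π y) := (measurable_of_countable c).comp hπ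
    have hsub : E n ⊆ (Ω ∪ {x | lam ≤ 2 * H x}) ∪ {x | ∃ i, T < ‖∫ y, P i (x - y) ∂ν‖} := by
      rintro x ⟨i, hi1, hi2⟩
      by_contra hx
      simp only [mem_union, not_or] at hx
      obtain ⟨⟨hxΩ, hxH⟩, hxν⟩ := hx
      have hxH : 2 * H x < lam := not_le.1 hxH
      have hxν : ‖∫ y, P i (x - y) ∂ν‖ ≤ T := not_lt.1 fun h => hxν ⟨i, h⟩
      have hosc : ∀ y, ‖P i (x - y) - P i (x - c (π y))‖ₑ ≤
          ENNReal.ofReal (C * 2 ^ (N + 1)) *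
            ENNReal.ofReal (d (π y) / (d (π y) + ‖x - c (π y)‖) ^ (N + 1)) +
          ENNReal.ofReal (L i * (1 / ((n : ℝ) + 1))) := by
        intro y
        have hdy := hd (π y)
        rw [← ofReal_norm]
        by_cases hy : π y ∈ bad
        · refine le_trans ?_ le_self_add
          rw [← ENNReal.ofReal_mul (by positivity)]
          refine ENNReal.ofReal_le_ofReal ?_
          have hfar : 2 * d (π y) < ‖x - c (π y)‖ := by
            by_contra h
            refine hxΩ (mem_biUnion hy ?_)
            rw [Metric.mem_closedBall, dist_eq_norm]
            exact not_lt.1 h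
          have e1 : (x - c (π y)) - (x - y) = y - c (π y) := by abel
          have h1 := hC i (x - c (π y)) (x - y) (by rw [e1]; linarith [hcd y])
          rw [e1, norm_sub_rev] at h1
          refine h1.trans ?_
          have hpos : 0 < ‖x - c (π y)‖ := by linarith
          have h2 : (d (π y) + ‖x - c (π y)‖) ^ (N + 1) ≤
              2 ^ (N + 1) * ‖x - c (π y)‖ ^ (N + 1) := by
            rw [← mul_pow]
            gcongr
            linarith
          rw [div_le_iff₀ (by positivity), mul_assoc, div_mul_eq_mul_div, mul_assoc]
          have h3 : d (π y) ≤ 2 ^ (N + 1) * (d (π y) * ‖x - c (π y)‖ ^ (N + 1) /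
              (d (π y) + ‖x - c (π y)‖) ^ (N + 1)) := by
            rw [← mul_div_assoc, le_div_iff₀ (by positivity)]
            nlinarith
          exact mul_le_mul_of_nonneg_left ((hcd y).trans h3) hC0
        · refine le_trans ?_ le_add_self
          refine ENNReal.ofReal_le_ofReal ?_
          have h1 := hL i (x - y) (x - c (π y))
          have e1 : (x - y) - (x - c (π y)) = c (π y) - y := by abel
          rw [e1, norm_sub_rev (c (π y))] at h1
          have h2 : ‖y - c (π y)‖ ≤ 1 / ((n : ℝ) + 1) := (hcd y).trans (hsmall y hy)
          exact h1.trans (mul_le_mul_of_nonneg_left h2 (hL0 i))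
      have h1 := enorm_integral_le_of_map_eq hπ hmap (f := fun y => P i (x - y))
        ((hcont i).measurable.comp (measurable_const.sub measurable_id)) (fun y => hM i _) c
        (D := fun j => ENNReal.ofReal (C * 2 ^ (N + 1)) *
            ENNReal.ofReal (d j / (d j + ‖x - c j‖) ^ (N + 1)) +
          ENNReal.ofReal (L i * (1 / ((n : ℝ) + 1)))) hosc
      rw [lintegral_add_right _ measurable_const, lintegral_const, mul_add] at h1
      have h2 : ‖∫ y, P i (x - y) ∂ν‖ₑ ≤ lam := by
        rw [← ofReal_norm]; exact ENNReal.ofReal_le_ofReal hxν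
      have h3 : ‖∫ y, P i (x - y) ∂μ‖ₑ ≤ lam + (lam + lam) :=
        h1.trans (add_le_add h2 (add_le_add hxH.le hi1))
      rw [← ofReal_norm, hlam, ← ENNReal.ofReal_add hT.le hT.le,
        ← ENNReal.ofReal_add hT.le (by positivity),
        ENNReal.ofReal_le_ofReal_iff (by positivity)] at h3
      linarith
    have hb1 : lam * volume Ω ≤ A₁ * μ univ := by
      calc lam * volume Ω ≤ lam * ∑' i : bad, volume (Metric.closedBall (c i) (2 * d i)) := by
            gcongr
            exact measure_biUnion_le _ (to_countable bad) _
        _ = ∑' i : bad, ENNReal.ofReal (2 ^ N) * v * (lam * ENNReal.ofReal (d i ^ N)) := by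
            rw [← ENNReal.tsum_mul_left]
            congr 1 with i
            rw [Measure.addHaar_closedBall _ _ (by linarith [hd i.1]), mul_pow]
            rw [← Measure.addHaar_unitClosedBall_eq_addHaar_unitBall]
            simp only [finrank_euclideanSpace, Fintype.card_fin]
            rw [ENNReal.ofReal_mul (by positivity)]
            ring
        _ ≤ ∑' i : bad, A₁ * μ (π ⁻¹' {i.1}) := by
            refine ENNReal.tsum_le_tsum fun i => ?_
            rw [hA₁, mul_assoc (ENNReal.ofReal (2 ^ N) * v)]
            exact mul_le_mul_right (hbad i.1 i.2) _
        _ = A₁ * μ (⋃ i : bad, π ⁻¹' {i.1}) := by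
            rw [ENNReal.tsum_mul_left, measure_iUnion _ fun i => hπ (measurableSet_singleton _)]
            intro i j hij
            refine Disjoint.preimage _ (disjoint_singleton.2 fun h => hij (Subtype.ext h))
        _ ≤ _ := by gcongr; exact subset_univ _
    have hb2 : lam * volume {x | lam ≤ 2 * H x} ≤ A₂ * μ univ := by
      have hmeas : Measurable (Function.uncurry fun (x y : Euc N) =>
          ENNReal.ofReal (C * 2 ^ (N + 1)) *
          ENNReal.ofReal (d (π y) / (d (π y) + ‖x - c (π y)‖) ^ (N + 1))) := by
        have h1 : Measurable fun p : Euc N × Euc N => d (π p.2) := hdm.comp measurable_snd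
        have h2 : Measurable fun p : Euc N × Euc N => c (π p.2) := hcm.comp measurable_snd
        refine measurable_const.mul (ENNReal.measurable_ofReal.comp ?_)
        exact h1.div ((h1.add (measurable_fst.sub h2).norm).pow_const _)
      have hHm : Measurable H := hmeas.lintegral_prod_right'
      refine (mul_meas_ge_le_lintegral (hHm.const_mul 2) lam).trans ?_
      rw [lintegral_const_mul _ hHm, hH, lintegral_lintegral_swap hmeas.aemeasurable, hA₂, mul_assoc]
      gcongr
      rw [← lintegral_const]
      refine lintegral_mono fun y => ?_
      rw [lintegral_const_mul _ (by fun_prop)]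
      gcongr
      exact hQ _ _ (hd _)
    have hb3 : lam * volume {x | ∃ i, T < ‖∫ y, P i (x - y) ∂ν‖} ≤ A₃ * μ univ := by
      have h1 := hB g (2 ^ N * lam) hg (by finiteness) hg1 (by rw [hgint]; finiteness) T hT
      have h2 : ∫⁻ x, g x ^ 2 ≤ 2 ^ N * lam * μ univ := by
        rw [← hgint, ← lintegral_const_mul _ hg]
        refine lintegral_mono fun x => ?_
        rw [sq]
        gcongr
        exact hg1 x
      rw [ENNReal.ofReal_pow hT.le, ← hlam, sq, mul_assoc] at h1
      rw [← ENNReal.mul_le_mul_iff_right hlam0 hlamtop]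
      refine (h1.trans (mul_le_mul_right h2 B)).trans_eq ?_
      rw [hA₃]
      ring
    calc lam * volume (E n) ≤ lam * ((volume Ω + volume {x | lam ≤ 2 * H x}) +
          volume {x | ∃ i, T < ‖∫ y, P i (x - y) ∂ν‖}) := by
          gcongr
          refine (measure_mono hsub).trans ((measure_union_le _ _).trans ?_)
          gcongr
          exact measure_union_le _ _
      _ ≤ _ := by rw [mul_add, mul_add, add_mul, add_mul]; gcongr
  calc ENNReal.ofReal (4 * T) * volume {x | ∃ i, 4 * T < ‖∫ y, P i (x - y) ∂μ‖}
      ≤ 4 * lam * volume (⋃ n, E n) := by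
        rw [ENNReal.ofReal_mul (by norm_num), ENNReal.ofReal_ofNat]
        gcongr
    _ = 4 * ⨆ n, lam * volume (E n) := by
        rw [hEmono.measure_iUnion, mul_assoc, ENNReal.mul_iSup]
    _ ≤ 4 * ((A₁ + A₂ + A₃) * μ univ) := by gcongr; exact iSup_le key
    _ = _ := by ring

/-! ### The convolution of a singular kernel with a dilated test function -/

/-- A real test function, regarded as a complex Schwartz function. -/
def complexify (ρ : 𝓓((⊤ : TopologicalSpace.Opens (Euc N)), ℝ)) : 𝓢(Euc N, ℂ) :=
  HasCompactSupport.toSchwartzMap (f := fun y => (ρ y : ℂ))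
    (ρ.hasCompactSupport.comp_left Complex.ofReal_zero)
    (Complex.ofRealCLM.contDiff.comp ρ.contDiff)

lemma complexify_apply (ρ : 𝓓((⊤ : TopologicalSpace.Opens (Euc N)), ℝ)) (y : Euc N) :
    complexify ρ y = ρ y := rfl

lemma dilatedAt_apply (ρ : 𝓓((⊤ : TopologicalSpace.Opens (Euc N)), ℝ)) (ε : Ioi (0 : ℝ))
    (x y : Euc N) :
    dilatedAt ρ ε x y = (((ε : ℝ) ^ N)⁻¹ * ρ ((ε : ℝ)⁻¹ • (x - y)) : ℝ) := rfl

lemma fourierInv_dilatedAt (ρ : 𝓓((⊤ : TopologicalSpace.Opens (Euc N)), ℝ)) (ε : Ioi (0 : ℝ))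
    (x η : Euc N) :
    𝓕⁻ (dilatedAt ρ ε x) η =
      Real.fourierChar (inner ℝ x η) • 𝓕 (complexify ρ) ((ε : ℝ) • η) := by
  have hε : 0 < (ε : ℝ) := ε.2
  rw [SchwartzMap.fourierInv_coe, Real.fourierInv_eq, SchwartzMap.fourier_coe, Real.fourier_eq]
  rw [← integral_sub_left_eq_self _ volume x]
  set G : Euc N → ℂ := fun w => (((ε : ℝ) ^ N)⁻¹ : ℝ) • (Real.fourierChar (inner ℝ x η) •
    (Real.fourierChar (-inner ℝ w ((ε : ℝ) • η)) • complexify ρ w)) with hG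
  have h : ∀ y : Euc N, Real.fourierChar (inner ℝ (x - y) η) • dilatedAt ρ ε x (x - y) =
      G ((ε : ℝ)⁻¹ • y) := by
    intro y
    have e : inner ℝ ((ε : ℝ)⁻¹ • y) ((ε : ℝ) • η) = inner ℝ y η := by
      rw [real_inner_smul_left, real_inner_smul_right, inv_mul_cancel_left₀ hε.ne']
    have e2 : Real.fourierChar (inner ℝ (x - y) η) =
        Real.fourierChar (inner ℝ x η) * Real.fourierChar (-inner ℝ y η) := by
      rw [inner_sub_left, sub_eq_add_neg, AddChar.map_add_eq_mul]
    simp only [hG, e, e2, dilatedAt_apply, complexify_apply, sub_sub_cancel,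
      Circle.smul_def, Circle.coe_mul, smul_eq_mul, Complex.real_smul, Complex.ofReal_mul]
    ring
  rw [integral_congr_ae (ae_of_all _ h), Measure.integral_comp_inv_smul_of_nonneg _ G hε.le, hG,
    integral_smul, smul_smul]
  simp only [finrank_euclideanSpace, Fintype.card_fin, Circle.smul_def]
  rw [integral_smul, mul_inv_cancel₀ (by positivity), one_smul]

lemma norm_fourierChar_sub_le (a b : ℝ) :
    ‖(Real.fourierChar a : ℂ) - Real.fourierChar b‖ ≤ 2 * Real.pi * |a - b| := by
  have h : (Real.fourierChar a : ℂ) =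
      Real.fourierChar b * Complex.exp (Complex.I * ((2 * Real.pi * (a - b) : ℝ) : ℂ)) := by
    rw [Real.fourierChar_apply, Real.fourierChar_apply, ← Complex.exp_add]
    congr 1
    push_cast
    ring
  rw [h, ← mul_sub_one, norm_mul, Circle.norm_coe, one_mul]
  refine Real.norm_exp_I_mul_ofReal_sub_one_le.trans_eq ?_
  rw [Real.norm_eq_abs, abs_mul, abs_of_pos (by positivity)]

lemma integrable_pow_mul_fourier (ρ : 𝓓((⊤ : TopologicalSpace.Opens (Euc N)), ℝ))
    (ε : Ioi (0 : ℝ)) (k : ℕ) :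
    Integrable fun ξ : Euc N => ‖ξ‖ ^ k * ‖𝓕 (complexify ρ) ((ε : ℝ) • ξ)‖ := by
  have hε : (ε : ℝ) ≠ 0 := (ne_of_gt ε.2)
  have h := (((𝓕 (complexify ρ)).integrable_pow_mul volume k).comp_smul hε).const_mul
    (((ε : ℝ) ^ k)⁻¹)
  refine h.congr (ae_of_all _ fun ξ => ?_)
  have : 0 < (ε : ℝ) := ε.2
  simp only [norm_smul, Real.norm_of_nonneg this.le, mul_pow]
  field_simp

namespace FundamentalKernel

variable (K : FundamentalKernel N)

lemma ae_norm_symbol_le : ∀ᵐ ξ : Euc N, ‖K.symbol ξ‖ ≤ ‖K.symbol‖ := by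
  have hq : Measure.QuasiMeasurePreserving (fun ξ : Euc N => -ξ) volume volume :=
    (Measure.measurePreserving_neg volume).quasiMeasurePreserving
  filter_upwards [hq.ae K.symbol_neg_mem.2] with ξ hξ
  simpa using hξ

lemma dist_eq_integral (φ : 𝓢(Euc N, ℂ)) : K.dist φ = ∫ ξ, 𝓕⁻ φ ξ * K.symbol ξ := by
  have h : (𝓕 K.dist) (𝓕⁻ φ) = K.dist φ := by
    rw [TemperedDistribution.fourier_apply, FourierTransform.fourier_fourierInv_eq]
  rw [← h, K.fourier_dist, Lp.toTemperedDistribution_apply]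
  rfl

lemma dist_dilatedAt (ρ : 𝓓((⊤ : TopologicalSpace.Opens (Euc N)), ℝ)) (ε : Ioi (0 : ℝ))
    (z : Euc N) :
    K.dist (dilatedAt ρ ε z) = ∫ ξ, Real.fourierChar (inner ℝ z ξ) •
      (𝓕 (complexify ρ) ((ε : ℝ) • ξ) * K.symbol ξ) := by
  rw [dist_eq_integral]
  congr 1 with ξ
  rw [fourierInv_dilatedAt, smul_mul_assoc]

/-- `S̃` applied to `ρ_ε(x - ·)` is the convolution of the kernel `K` with `ρ_ε`. -/
lemma reflectedOp_dilatedAt (ρ : 𝓓((⊤ : TopologicalSpace.Opens (Euc N)), ℝ)) (ε : Ioi (0 : ℝ))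
    (x y : Euc N) :
    K.reflectedOp (dilatedAt ρ ε x) y = K.dist (dilatedAt ρ ε (x - y)) := by
  rw [reflectedOp_apply, dist_dilatedAt, ← integral_neg_eq_self]
  congr 1 with ξ
  have h : 𝓕 (dilatedAt ρ ε x) (-ξ) = 𝓕⁻ (dilatedAt ρ ε x) ξ := by
    rw [SchwartzMap.fourierInv_coe, Real.fourierInv_eq_fourier_neg, SchwartzMap.fourier_coe]
  rw [neg_neg, h, fourierInv_dilatedAt, inner_neg_left, inner_sub_left, real_inner_comm ξ y,
    sub_eq_add_neg, AddChar.map_add_eq_mul]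
  simp only [Circle.smul_def, Circle.coe_mul, smul_eq_mul]
  ring

lemma aestronglyMeasurable_fourier_mul (ρ : 𝓓((⊤ : TopologicalSpace.Opens (Euc N)), ℝ))
    (ε : Ioi (0 : ℝ)) :
    AEStronglyMeasurable (fun ξ : Euc N => 𝓕 (complexify ρ) ((ε : ℝ) • ξ) * K.symbol ξ) := by
  refine AEStronglyMeasurable.mul ?_ (Lp.aestronglyMeasurable K.symbol)
  exact ((𝓕 (complexify ρ)).continuous.comp (continuous_const_smul _)).aestronglyMeasurable

lemma integrable_fourier_mul (ρ : 𝓓((⊤ : TopologicalSpace.Opens (Euc N)), ℝ))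
    (ε : Ioi (0 : ℝ)) :
    Integrable fun ξ : Euc N => 𝓕 (complexify ρ) ((ε : ℝ) • ξ) * K.symbol ξ := by
  refine ((integrable_pow_mul_fourier ρ ε 0).const_mul ‖K.symbol‖).mono'
    (K.aestronglyMeasurable_fourier_mul ρ ε) ?_
  filter_upwards [K.ae_norm_symbol_le] with ξ hξ
  rw [norm_mul, pow_zero, one_mul, mul_comm]
  gcongr

lemma exists_norm_dist_dilatedAt_le (ρ : 𝓓((⊤ : TopologicalSpace.Opens (Euc N)), ℝ))
    (ε : Ioi (0 : ℝ)) : ∃ M : ℝ, ∀ z, ‖K.dist (dilatedAt ρ ε z)‖ ≤ M := by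
  refine ⟨∫ ξ, ‖𝓕 (complexify ρ) ((ε : ℝ) • ξ) * K.symbol ξ‖, fun z => ?_⟩
  rw [dist_dilatedAt]
  refine (norm_integral_le_integral_norm _).trans_eq ?_
  simp_rw [Circle.norm_smul]

/-- The bound for the oscillation of `K * ρ_ε` which only uses the boundedness of the symbol. -/
lemma norm_dist_dilatedAt_sub_le (ρ : 𝓓((⊤ : TopologicalSpace.Opens (Euc N)), ℝ))
    (ε : Ioi (0 : ℝ)) (z w : Euc N) :
    ‖K.dist (dilatedAt ρ ε z) - K.dist (dilatedAt ρ ε w)‖ ≤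
      2 * Real.pi * ‖K.symbol‖ * (∫ ξ, ‖ξ‖ * ‖𝓕 (complexify ρ) ξ‖) / (ε : ℝ) ^ (N + 1) *
        ‖z - w‖ := by
  have hε : 0 < (ε : ℝ) := ε.2
  have hI : ∀ x : Euc N, Integrable fun ξ : Euc N => Real.fourierChar (inner ℝ x ξ) •
      (𝓕 (complexify ρ) ((ε : ℝ) • ξ) * K.symbol ξ) := by
    intro x
    have := (Real.fourierIntegral_convergent_iff (-x)).2 (K.integrable_fourier_mul ρ ε)
    simpa [real_inner_comm] using this
  have hscale : ∫ ξ, ‖ξ‖ ^ 1 * ‖𝓕 (complexify ρ) ((ε : ℝ) • ξ)‖ =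
      (∫ ξ, ‖ξ‖ * ‖𝓕 (complexify ρ) ξ‖) / (ε : ℝ) ^ (N + 1) := by
    have h1 : ∀ ξ : Euc N, ‖ξ‖ ^ 1 * ‖𝓕 (complexify ρ) ((ε : ℝ) • ξ)‖ =
        (fun ζ : Euc N => (ε : ℝ)⁻¹ * (‖ζ‖ * ‖𝓕 (complexify ρ) ζ‖)) ((ε : ℝ) • ξ) := by
      intro ξ
      simp only [norm_smul, Real.norm_of_nonneg hε.le]
      field_simp
    simp_rw [h1]
    rw [Measure.integral_comp_smul_of_nonneg volume
      (fun ζ : Euc N => (ε : ℝ)⁻¹ * (‖ζ‖ * ‖𝓕 (complexify ρ) ζ‖)) _ (hR := hε.le),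
      integral_const_mul]
    simp only [finrank_euclideanSpace, Fintype.card_fin, smul_eq_mul]
    rw [pow_succ]
    field_simp
  rw [dist_dilatedAt, dist_dilatedAt, ← integral_sub (hI z) (hI w)]
  have hb : ∀ᵐ ξ : Euc N, ‖Real.fourierChar (inner ℝ z ξ) •
      (𝓕 (complexify ρ) ((ε : ℝ) • ξ) * K.symbol ξ) - Real.fourierChar (inner ℝ w ξ) •
      (𝓕 (complexify ρ) ((ε : ℝ) • ξ) * K.symbol ξ)‖ ≤
      2 * Real.pi * ‖K.symbol‖ * ‖z - w‖ * (‖ξ‖ ^ 1 * ‖𝓕 (complexify ρ) ((ε : ℝ) • ξ)‖) := by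
    filter_upwards [K.ae_norm_symbol_le] with ξ hξ
    rw [Circle.smul_def, Circle.smul_def, ← sub_smul, norm_smul, norm_mul]
    have h1 := norm_fourierChar_sub_le (inner ℝ z ξ) (inner ℝ w ξ)
    rw [← inner_sub_left] at h1
    have h2 : |inner ℝ (z - w) ξ| ≤ ‖z - w‖ * ‖ξ‖ := abs_real_inner_le_norm _ _
    calc _ ≤ (2 * Real.pi * (‖z - w‖ * ‖ξ‖)) *
          (‖𝓕 (complexify ρ) ((ε : ℝ) • ξ)‖ * ‖K.symbol‖) := by
          gcongr
          exact h1.trans (by gcongr)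
      _ = _ := by ring
  refine (norm_integral_le_of_norm_le ((integrable_pow_mul_fourier ρ ε 1).const_mul _) hb).trans_eq ?_
  rw [integral_const_mul, hscale]
  ring

/-- Away from the origin `K * ρ_ε` is given by an absolutely convergent integral. -/
lemma dist_dilatedAt_of_lt {ρ : 𝓓((⊤ : TopologicalSpace.Opens (Euc N)), ℝ)}
    (hρ : ∀ w, ρ w ≠ 0 → ‖w‖ ≤ 1) {ε : Ioi (0 : ℝ)} {z : Euc N} (hz : ε < ‖z‖) :
    IntegrableOn (fun y => K.offOrigin (z - y) * (((ε : ℝ) ^ N)⁻¹ * ρ ((ε : ℝ)⁻¹ • y) : ℝ))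
      (Metric.closedBall 0 ε) ∧
    K.dist (dilatedAt ρ ε z) = ∫ y in Metric.closedBall 0 (ε : ℝ),
      K.offOrigin (z - y) * (((ε : ℝ) ^ N)⁻¹ * ρ ((ε : ℝ)⁻¹ • y) : ℝ) := by
  have hε : 0 < (ε : ℝ) := ε.2
  have hsupp : ∀ y : Euc N, y ∉ Metric.closedBall 0 (ε : ℝ) → ρ ((ε : ℝ)⁻¹ • y) = 0 := by
    intro y hy
    by_contra h
    refine hy ?_
    have := hρ _ h
    rw [norm_smul, norm_inv, Real.norm_of_nonneg hε.le, inv_mul_le_iff₀ hε, mul_one] at this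
    simpa using this
  have hts : tsupport (dilatedAt ρ ε z) ⊆ Metric.closedBall z ε := by
    refine closure_minimal (fun y hy => ?_) Metric.isClosed_closedBall
    by_contra hy2
    refine hy ?_
    rw [dilatedAt_apply, hsupp (z - y) (by simpa [dist_eq_norm, norm_sub_rev] using hy2)]
    simp
  have hcs : HasCompactSupport (dilatedAt ρ ε z) :=
    HasCompactSupport.of_support_subset_isCompact (isCompact_closedBall z (ε : ℝ))
      ((subset_tsupport _).trans hts)
  have h0 : (0 : Euc N) ∉ tsupport (dilatedAt ρ ε z) := fun h => by
    have := hts h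
    rw [Metric.mem_closedBall, dist_zero_left] at this
    linarith
  constructor
  · refine ContinuousOn.integrableOn_compact (isCompact_closedBall _ _) ?_
    refine ContinuousOn.mul ?_ ?_
    · refine K.contDiffOn.continuousOn.comp (by fun_prop) fun y hy => ?_
      rw [mem_compl_iff, mem_singleton_iff, sub_eq_zero]
      rintro rfl
      simp only [Metric.mem_closedBall, dist_zero_right] at hy
      linarith
    · have : Continuous ρ := ρ.contDiff.continuous
      fun_prop
  · rw [K.dist_apply _ hcs h0, ← integral_sub_left_eq_self _ volume z,
      setIntegral_eq_integral_of_forall_compl_eq_zero fun y hy => by rw [hsupp y hy]; simp]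
    simp only [dilatedAt_apply, sub_sub_cancel]

lemma norm_offOrigin_sub_le {C : ℝ} (hC : ∀ x, x ≠ 0 → ‖fderiv ℝ K.offOrigin x‖ ≤ C / ‖x‖ ^ (N + 1))
    (hC0 : 0 ≤ C) {r : ℝ} (hr : 0 < r) {a b : Euc N} (h : ∀ p ∈ segment ℝ a b, r ≤ ‖p‖) :
    ‖K.offOrigin a - K.offOrigin b‖ ≤ C / r ^ (N + 1) * ‖a - b‖ := by
  have hne : ∀ p ∈ segment ℝ a b, p ≠ 0 := by
    rintro p hp rfl
    have := h 0 hp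
    rw [norm_zero] at this
    linarith
  refine (convex_segment a b).norm_image_sub_le_of_norm_fderiv_le (𝕜 := ℝ) (fun p hp => ?_)
    (fun p hp => ?_) (right_mem_segment ℝ a b) (left_mem_segment ℝ a b)
  · exact (K.contDiffOn.differentiableOn one_ne_zero).differentiableAt
      (isOpen_compl_singleton.mem_nhds (hne p hp))
  · refine (hC p (hne p hp)).trans ?_
    have := h p hp
    gcongr

/-- Hörmander's condition for `K * ρ_ε`, in its pointwise form, with a constant which only depends
on bounds for `ρ` and its Fourier transform. -/
lemma exists_regularity (R D : ℝ) : ∃ C : ℝ, 0 ≤ C ∧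
    ∀ (ρ : 𝓓((⊤ : TopologicalSpace.Opens (Euc N)), ℝ)) (ε : Ioi (0 : ℝ)) (z w : Euc N),
      (∀ w, ρ w ≠ 0 → ‖w‖ ≤ 1) → (∀ w, |ρ w| ≤ R) →
      ∫ ξ, ‖ξ‖ * ‖𝓕 (complexify ρ) ξ‖ ≤ D → 2 * ‖z - w‖ ≤ ‖z‖ →
      ‖K.dist (dilatedAt ρ ε z) - K.dist (dilatedAt ρ ε w)‖ ≤
        C * ‖z - w‖ / ‖z‖ ^ (N + 1) := by
  obtain ⟨C₁, hC₁⟩ := K.gradient_bound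
  set C₂ := max C₁ 0 with hC₂
  have hC₂0 : 0 ≤ C₂ := le_max_right _ _
  have hgrad : ∀ x, x ≠ 0 → ‖fderiv ℝ K.offOrigin x‖ ≤ C₂ / ‖x‖ ^ (N + 1) := fun x hx =>
    (hC₁ x hx).trans (by gcongr; exact le_max_left _ _)
  set v := volume.real (Metric.closedBall (0 : Euc N) 1) with hv
  set a := 2 * Real.pi * ‖K.symbol‖ * max D 0 * 4 ^ (N + 1) with ha
  set b := C₂ * 4 ^ (N + 1) * max R 0 * v with hb
  have ha0 : 0 ≤ a := by positivity
  have hb0 : 0 ≤ b := by positivity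
  refine ⟨a + b, by positivity, fun ρ ε z w hsupp hR hD hzw => ?_⟩
  have hε : 0 < (ε : ℝ) := ε.2
  rcases eq_or_ne z 0 with rfl | hz
  · have : w = 0 := by
      rw [norm_zero, zero_sub, norm_neg] at hzw
      exact norm_eq_zero.1 (by linarith [norm_nonneg w])
    simp [this]
  have hzpos : 0 < ‖z‖ := norm_pos_iff.2 hz
  rcases le_or_gt (‖z‖ / 4) ε with hcase | hcase
  · refine (K.norm_dist_dilatedAt_sub_le ρ ε z w).trans ?_
    calc _ ≤ 2 * Real.pi * ‖K.symbol‖ * max D 0 / (‖z‖ / 4) ^ (N + 1) * ‖z - w‖ := by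
          gcongr
          exact hD.trans (le_max_left _ _)
      _ = a * ‖z - w‖ / ‖z‖ ^ (N + 1) := by rw [ha, div_pow]; field_simp
      _ ≤ _ := by gcongr; linarith
  · have hw : ‖z‖ / 2 ≤ ‖w‖ := by
      have := norm_sub_norm_le z w
      linarith
    obtain ⟨hi1, he1⟩ := K.dist_dilatedAt_of_lt hsupp (ε := ε) (z := z) (by linarith)
    obtain ⟨hi2, he2⟩ := K.dist_dilatedAt_of_lt hsupp (ε := ε) (z := w) (by linarith)
    rw [he1, he2, ← integral_sub hi1 hi2]
    have hbound : ∀ y ∈ Metric.closedBall (0 : Euc N) (ε : ℝ),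
        ‖K.offOrigin (z - y) * (((ε : ℝ) ^ N)⁻¹ * ρ ((ε : ℝ)⁻¹ • y) : ℝ) -
          K.offOrigin (w - y) * (((ε : ℝ) ^ N)⁻¹ * ρ ((ε : ℝ)⁻¹ • y) : ℝ)‖ ≤
        C₂ / (‖z‖ / 4) ^ (N + 1) * ‖z - w‖ * (((ε : ℝ) ^ N)⁻¹ * max R 0) := by
      intro y hy
      rw [mem_closedBall_zero_iff] at hy
      rw [← sub_mul, norm_mul]
      have h1 : ‖K.offOrigin (z - y) - K.offOrigin (w - y)‖ ≤
          C₂ / (‖z‖ / 4) ^ (N + 1) * ‖z - w‖ := by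
        have := K.norm_offOrigin_sub_le hgrad hC₂0 (r := ‖z‖ / 4) (by positivity)
          (a := z - y) (b := w - y) ?_
        · rwa [sub_sub_sub_cancel_right] at this
        · intro p hp
          have h2 : ‖p - (z - y)‖ ≤ ‖(z - y) - (w - y)‖ := by
            have := norm_sub_le_of_mem_segment hp
            rwa [norm_sub_rev (w - y)] at this
          rw [sub_sub_sub_cancel_right] at h2
          have h3 : ‖z‖ ≤ ‖p‖ + ‖p - (z - y)‖ + ‖y‖ := by
            have : z = p - (p - (z - y)) + y := by abel
            calc ‖z‖ = ‖p - (p - (z - y)) + y‖ := by rw [← this]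
              _ ≤ ‖p - (p - (z - y))‖ + ‖y‖ := norm_add_le _ _
              _ ≤ _ := by gcongr; exact norm_sub_le _ _
          linarith
      have h2 : ‖((((ε : ℝ) ^ N)⁻¹ * ρ ((ε : ℝ)⁻¹ • y) : ℝ) : ℂ)‖ ≤
          ((ε : ℝ) ^ N)⁻¹ * max R 0 := by
        rw [Complex.norm_real, norm_mul, Real.norm_of_nonneg (by positivity), Real.norm_eq_abs]
        gcongr
        exact (hR _).trans (le_max_left _ _)
      gcongr
    refine (norm_setIntegral_le_of_norm_le_const measure_closedBall_lt_top hbound).trans ?_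
    have hvol : volume.real (Metric.closedBall (0 : Euc N) (ε : ℝ)) = (ε : ℝ) ^ N * v := by
      rw [hv, Measure.real, Measure.real, Measure.addHaar_closedBall _ _ hε.le,
        Measure.addHaar_unitClosedBall_eq_addHaar_unitBall, ENNReal.toReal_mul,
        ENNReal.toReal_ofReal (by positivity)]
      simp
    rw [hvol]
    calc _ = b * ‖z - w‖ / ‖z‖ ^ (N + 1) := by rw [hb, div_pow]; field_simp
      _ ≤ _ := by gcongr; linarith

end FundamentalKernel

/-! ### The `L²` theory -/

lemma integral_fourierInv_mul_eq {f g : Euc N → ℂ} (hf : Integrable f) (hg : Integrable g) :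
    ∫ y, 𝓕⁻ f y * g y = ∫ ξ, f ξ * 𝓕⁻ g ξ := by
  have h := VectorFourier.integral_fourierIntegral_smul_eq_flip (μ := volume) (ν := volume)
    (L := innerₗ (Euc N)) Real.continuous_fourierChar continuous_inner hf hg.comp_neg
  rw [flip_innerₗ] at h
  rw [← integral_neg_eq_self, Real.fourierInv_eq_fourier_comp_neg g]
  simp only [Real.fourierInv_eq_fourier_neg f, neg_neg]
  exact h

/-- On `L¹ ∩ L²` the Fourier transform of `L²` is given by the Fourier integral. -/
lemma coeFn_fourierInv_toLp_ae_eq {g : Euc N → ℂ} (h1 : Integrable g) (h2 : MemLp g 2) :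
    ∀ᵐ ξ, 𝓕⁻ g ξ = (𝓕⁻ (h2.toLp g) : Lp ℂ 2 (volume : Measure (Euc N))) ξ := by
  have hcont : Continuous (𝓕⁻ g) := by
    rw [Real.fourierInv_eq_fourier_comp_neg]
    exact VectorFourier.fourierIntegral_continuous (L := innerₗ (Euc N))
      Real.continuous_fourierChar continuous_inner h1.comp_neg
  refine ae_eq_of_integral_contDiff_smul_eq hcont.locallyIntegrable
    ((Lp.memLp _).locallyIntegrable one_le_two) fun ψ hψ hψc => ?_
  set φ : 𝓢(Euc N, ℂ) := HasCompactSupport.toSchwartzMap (f := fun y => (ψ y : ℂ))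
    (hψc.comp_left Complex.ofReal_zero) (Complex.ofRealCLM.contDiff.comp hψ) with hφ
  have hφψ : ∀ x, φ x = (ψ x : ℂ) := fun x => rfl
  have e1 : ∫ x, ψ x • 𝓕⁻ g x = ∫ y, 𝓕⁻ φ y * g y := by
    rw [SchwartzMap.fourierInv_coe, integral_fourierInv_mul_eq φ.integrable h1]
    simp only [hφψ, Complex.real_smul]
  have e2 : ∫ x, ψ x • (𝓕⁻ (h2.toLp g) : Lp ℂ 2 (volume : Measure (Euc N))) x = ∫ y, 𝓕⁻ φ y * g y := by
    have h := congrArg (fun T : 𝓢'(Euc N, ℂ) => T φ)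
      (Lp.fourierInv_toTemperedDistribution_eq (h2.toLp g))
    simp only [TemperedDistribution.fourierInv_apply, Lp.toTemperedDistribution_apply,
      smul_eq_mul] at h
    simp only [Complex.real_smul, ← hφψ]
    rw [← h]
    refine integral_congr_ae ?_
    filter_upwards [h2.coeFn_toLp] with x hx
    rw [hx]
  rw [e1, e2]

namespace FundamentalKernel

variable (K : FundamentalKernel N)

/-- On `L¹ ∩ L²` the singular integral operator is represented by a bounded operator of `L²`, by
Plancherel's theorem. -/
lemma exists_integral_reflectedOp_mul_eq {g : Euc N → ℂ} (h1 : Integrable g) (h2 : MemLp g 2) :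
    ∃ G : Lp ℂ 2 (volume : Measure (Euc N)), ‖G‖ ≤ ‖K.symbol‖ * ‖h2.toLp g‖ ∧
      ∀ φ : 𝓢(Euc N, ℂ), ∫ y, K.reflectedOp φ y * g y = ∫ y, φ y * G y := by
  obtain ⟨hm, hb⟩ := K.symbol_neg_mem
  set g' : Lp ℂ 2 (volume : Measure (Euc N)) := 𝓕⁻ (h2.toLp g) with hg'
  have hle : ∀ᵐ ξ : Euc N, ‖K.symbol (-ξ) * g' ξ‖ ≤ ‖K.symbol‖ * ‖g' ξ‖ := by
    filter_upwards [hb] with ξ hξ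
    rw [norm_mul]
    gcongr
  have hW : MemLp (fun ξ => K.symbol (-ξ) * g' ξ) 2 :=
    (Lp.memLp g').of_le_mul (hm.mul (Lp.aestronglyMeasurable g')) hle
  refine ⟨𝓕 (hW.toLp _), ?_, fun φ => ?_⟩
  · rw [Lp.norm_fourier_eq]
    have hn : ‖g'‖ = ‖h2.toLp g‖ := by
      rw [← Lp.norm_fourier_eq, hg', FourierTransform.fourier_fourierInv_eq]
    rw [← hn]
    refine Lp.norm_le_mul_norm_of_ae_le_mul ?_
    filter_upwards [hle, hW.coeFn_toLp] with ξ h3 h4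
    rwa [h4]
  · have e1 : ∫ y, K.reflectedOp φ y * g y = ∫ ξ, 𝓕 φ ξ * (hW.toLp _) ξ := by
      unfold reflectedOp fourierMult
      rw [integral_fourierInv_mul_eq ((𝓕 φ).integrable.bdd_mul hm hb) h1]
      refine integral_congr_ae ?_
      filter_upwards [coeFn_fourierInv_toLp_ae_eq h1 h2, hW.coeFn_toLp] with ξ h3 h4
      rw [h4, h3]
      ring
    have h := congrArg (fun T : 𝓢'(Euc N, ℂ) => T φ)
      (Lp.fourier_toTemperedDistribution_eq (hW.toLp _))
    simp only [TemperedDistribution.fourier_apply, Lp.toTemperedDistribution_apply,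
      smul_eq_mul] at h
    rw [e1, h]

end FundamentalKernel

lemma lintegral_enorm_sq_eq (f : Lp ℂ 2 (volume : Measure (Euc N))) :
    ∫⁻ x, ‖f x‖ₑ ^ 2 = ENNReal.ofReal (‖f‖ ^ 2) := by
  have h := eLpNorm_nnreal_pow_eq_lintegral (μ := (volume : Measure (Euc N))) (f := f)
    (p := 2) two_ne_zero
  simp only [NNReal.coe_ofNat, ENNReal.rpow_ofNat, ENNReal.coe_ofNat] at h
  rw [← h, Lp.norm_def, ← ENNReal.toReal_pow, ENNReal.ofReal_toReal]
  exact ENNReal.pow_ne_top (Lp.eLpNorm_ne_top f)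

/-- If the averages of `|G|²` over balls centred at `x` are at most `κ²`, then the pairing of `G`
with the dilates `ρ_ε(x - ·)` is controlled by `κ`. -/
lemma enorm_integral_dilatedAt_mul_le {ρ : 𝓓((⊤ : TopologicalSpace.Opens (Euc N)), ℝ)} {R : ℝ}
    (hρ : ∀ w, ρ w ≠ 0 → ‖w‖ ≤ 1) (hR : ∀ w, |ρ w| ≤ R) (ε : Ioi (0 : ℝ)) (x : Euc N)
    {G : Euc N → ℂ} {κ : ℝ≥0∞} (h0 : κ ≠ 0) (h1 : κ ≠ ⊤)
    (hκ : ∫⁻ y in Metric.closedBall x (ε : ℝ), ‖G y‖ₑ ^ 2 ≤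
      κ ^ 2 * volume (Metric.closedBall x (ε : ℝ))) :
    ‖∫ y, dilatedAt ρ ε x y * G y‖ₑ ≤
      ENNReal.ofReal R * (2 * κ * volume (Metric.closedBall (0 : Euc N) 1)) := by
  have hε : 0 < (ε : ℝ) := ε.2
  have hout : ∀ y, y ∉ Metric.closedBall x (ε : ℝ) → dilatedAt ρ ε x y * G y = 0 := by
    intro y hy
    have : ρ ((ε : ℝ)⁻¹ • (x - y)) = 0 := by
      by_contra h
      refine hy ?_
      have := hρ _ h
      rw [norm_smul, norm_inv, Real.norm_of_nonneg hε.le, inv_mul_le_iff₀ hε, mul_one,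
        norm_sub_rev] at this
      rwa [Metric.mem_closedBall, dist_eq_norm]
    rw [dilatedAt_apply, this]
    simp
  rw [← setIntegral_eq_integral_of_forall_compl_eq_zero hout]
  set b := Metric.closedBall x (ε : ℝ) with hb
  have hvol : volume b = ENNReal.ofReal ((ε : ℝ) ^ N) *
      volume (Metric.closedBall (0 : Euc N) 1) := by
    rw [hb, Measure.addHaar_closedBall _ _ hε.le, Measure.addHaar_unitClosedBall_eq_addHaar_unitBall]
    simp
  -- The elementary inequality `a ≤ κ + a² / κ` replaces the Cauchy–Schwarz inequality.
  have hel : ∀ a : ℝ≥0∞, a ≤ κ + a ^ 2 / κ := by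
    intro a
    rcases le_total a κ with h | h
    · exact h.trans le_self_add
    · refine le_trans ?_ le_add_self
      rw [ENNReal.le_div_iff_mul_le (Or.inl h0) (Or.inl h1), sq]
      gcongr
  have hint : ∫⁻ y in b, ‖G y‖ₑ ≤ 2 * κ * volume b := by
    calc ∫⁻ y in b, ‖G y‖ₑ ≤ ∫⁻ y in b, (κ + ‖G y‖ₑ ^ 2 / κ) := lintegral_mono fun y => hel _
      _ = κ * volume b + (∫⁻ y in b, ‖G y‖ₑ ^ 2) / κ := by
        rw [lintegral_add_left measurable_const, setLIntegral_const]
        simp_rw [div_eq_mul_inv]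
        rw [lintegral_mul_const' _ _ (ENNReal.inv_ne_top.2 h0)]
      _ ≤ κ * volume b + κ * volume b := by
        gcongr
        refine ENNReal.div_le_of_le_mul (hκ.trans_eq ?_)
        ring
      _ = _ := by ring
  calc ‖∫ y in b, dilatedAt ρ ε x y * G y‖ₑ
      ≤ ∫⁻ y in b, ‖dilatedAt ρ ε x y * G y‖ₑ := enorm_integral_le_lintegral_enorm _
    _ ≤ ∫⁻ y in b, ENNReal.ofReal (((ε : ℝ) ^ N)⁻¹ * R) * ‖G y‖ₑ := by
      refine lintegral_mono fun y => ?_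
      rw [enorm_mul]
      gcongr
      rw [dilatedAt_apply, ← ofReal_norm, Complex.norm_real, norm_mul,
        Real.norm_of_nonneg (by positivity), Real.norm_eq_abs]
      gcongr
      exact hR _
    _ ≤ ENNReal.ofReal (((ε : ℝ) ^ N)⁻¹ * R) * (2 * κ * volume b) := by
      rw [lintegral_const_mul' _ _ ENNReal.ofReal_ne_top]
      gcongr
    _ = ENNReal.ofReal R * (2 * κ * volume (Metric.closedBall (0 : Euc N) 1)) *
        (ENNReal.ofReal (((ε : ℝ) ^ N)⁻¹) * ENNReal.ofReal ((ε : ℝ) ^ N)) := by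
      rw [hvol, ENNReal.ofReal_mul (by positivity)]
      ring
    _ = _ := by
      rw [← ENNReal.ofReal_mul (by positivity), inv_mul_cancel₀ (by positivity),
        ENNReal.ofReal_one, mul_one]

/-- The weak type `(2,2)` bound for the maximal function of `S g` relative to a family of test
functions which are bounded and supported in the unit ball. -/
lemma FundamentalKernel.exists_weak_type_two (K : FundamentalKernel N) {ι : Type*}
    {ρ : ι → 𝓓((⊤ : TopologicalSpace.Opens (Euc N)), ℝ)} {R : ℝ}
    (hρ : ∀ ν w, ρ ν w ≠ 0 → ‖w‖ ≤ 1) (hR : ∀ ν w, |ρ ν w| ≤ R) :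
    ∃ B : ℝ≥0∞, B ≠ ⊤ ∧ ∀ (g : Euc N → ℝ≥0∞) (M : ℝ≥0∞), Measurable g → M ≠ ⊤ →
      (∀ x, g x ≤ M) → ∫⁻ x, g x ≠ ⊤ → ∀ t : ℝ, 0 < t →
      ENNReal.ofReal (t ^ 2) * volume {x | ∃ i : ι × Ioi (0 : ℝ),
        t < ‖∫ y, K.dist (dilatedAt (ρ i.1) i.2 (x - y)) ∂(volume.withDensity g)‖} ≤
        B * ∫⁻ x, g x ^ 2 := by
  set v := volume (Metric.closedBall (0 : Euc N) 1) with hv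
  have hvtop : v ≠ ⊤ := measure_closedBall_lt_top.ne
  set c : ℝ := max R 1 * (2 * v.toReal) with hc
  have hv0 : v ≠ 0 := (Metric.measure_closedBall_pos _ _ one_pos).ne'
  have hc0 : 0 < c := by
    have : 0 < v.toReal := ENNReal.toReal_pos hv0 hvtop
    positivity
  refine ⟨ENNReal.ofReal (c ^ 2) * (ENNReal.ofReal (5 ^ N) * ENNReal.ofReal (‖K.symbol‖ ^ 2)),
    by finiteness, fun g M hg hM hgM hgint t ht => ?_⟩
  have hgtop : ∀ x, g x ≠ ⊤ := fun x => ((hgM x).trans_lt hM.lt_top).ne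
  set f : Euc N → ℂ := fun x => ((g x).toReal : ℂ) with hf
  have hfn : ∀ x, ‖f x‖ = (g x).toReal := fun x => by
    rw [hf, Complex.norm_real, Real.norm_of_nonneg ENNReal.toReal_nonneg]
  have hfe : ∀ x, ‖f x‖ₑ = g x := fun x => by
    rw [← ofReal_norm, hfn, ENNReal.ofReal_toReal (hgtop x)]
  have h1 : Integrable f := (integrable_toReal_of_lintegral_ne_top hg.aemeasurable hgint).ofReal
  have h2 : MemLp f 2 := by
    rw [memLp_two_iff_integrable_sq_norm h1.1]
    refine (h1.norm.const_mul M.toReal).mono' (h1.1.norm.pow 2) (ae_of_all _ fun x => ?_)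
    rw [Real.norm_of_nonneg (by positivity), sq]
    gcongr
    rw [hfn]
    exact ENNReal.toReal_mono hM (hgM x)
  obtain ⟨G, hGn, hG⟩ := K.exists_integral_reflectedOp_mul_eq h1 h2
  have hGsq : ∫⁻ x, ‖G x‖ₑ ^ 2 ≤ ENNReal.ofReal (‖K.symbol‖ ^ 2) * ∫⁻ x, g x ^ 2 := by
    have e : ∫⁻ x, g x ^ 2 = ENNReal.ofReal (‖h2.toLp f‖ ^ 2) := by
      rw [← lintegral_enorm_sq_eq]
      refine lintegral_congr_ae ?_
      filter_upwards [h2.coeFn_toLp] with x hx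
      rw [hx, hfe]
    rw [lintegral_enorm_sq_eq, e, ← ENNReal.ofReal_mul (by positivity), ← mul_pow]
    gcongr
  set κ : ℝ≥0∞ := ENNReal.ofReal (t / c) with hκ
  have hκ0 : κ ≠ 0 := (ENNReal.ofReal_pos.2 (by positivity)).ne'
  have hsub : {x | ∃ i : ι × Ioi (0 : ℝ),
      t < ‖∫ y, K.dist (dilatedAt (ρ i.1) i.2 (x - y)) ∂(volume.withDensity g)‖} ⊆
      {x | ∃ r : ℝ, 0 < r ∧ κ ^ 2 * volume (Metric.closedBall x r) <
        (volume.withDensity fun y => ‖G y‖ₑ ^ 2) (Metric.closedBall x r)} := by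
    rintro x ⟨⟨ν, ε⟩, hi⟩
    refine ⟨ε, ε.2, ?_⟩
    by_contra hcon
    rw [not_lt, withDensity_apply _ Metric.isClosed_closedBall.measurableSet] at hcon
    have h3 := enorm_integral_dilatedAt_mul_le (hρ ν) (fun w => (hR ν w).trans (le_max_left R 1)) ε x
      hκ0 ENNReal.ofReal_ne_top hcon
    rw [← hG] at h3
    rw [integral_withDensity_eq_integral_toReal_smul hg (ae_of_all _ fun x => (hgtop x).lt_top)] at hi
    have e : ∀ y, (g y).toReal • K.dist (dilatedAt (ρ ν) ε (x - y)) =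
        K.reflectedOp (dilatedAt (ρ ν) ε x) y * f y := fun y => by
      rw [K.reflectedOp_dilatedAt, Complex.real_smul, mul_comm]
    simp only [e] at hi
    have e3 : 2 * κ * v = ENNReal.ofReal (2 * (t / c) * v.toReal) := by
      rw [ENNReal.ofReal_mul (by positivity), ENNReal.ofReal_mul (by norm_num),
        ENNReal.ofReal_ofNat, ENNReal.ofReal_toReal hvtop]
    rw [← hv, e3, ← ofReal_norm, ← ENNReal.ofReal_mul (by positivity),
      ENNReal.ofReal_le_ofReal_iff (by positivity)] at h3
    have e2 : max R 1 * (2 * (t / c) * v.toReal) = t := by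
      rw [hc]
      have : 0 < v.toReal := ENNReal.toReal_pos hv0 hvtop
      field_simp
    linarith
  have h5 := mul_volume_exists_closedBall_lt_le (volume.withDensity fun y => ‖G y‖ₑ ^ 2) (κ ^ 2)
  rw [withDensity_apply _ MeasurableSet.univ, Measure.restrict_univ] at h5
  have et : ENNReal.ofReal (t ^ 2) = ENNReal.ofReal (c ^ 2) * κ ^ 2 := by
    rw [hκ, ← ENNReal.ofReal_pow (by positivity), ← ENNReal.ofReal_mul (by positivity), ← mul_pow,
      mul_div_cancel₀ _ hc0.ne']
  rw [et, mul_assoc, mul_assoc]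
  refine mul_le_mul_right ?_ _
  refine (mul_le_mul_right (measure_mono hsub) _).trans (h5.trans ?_)
  rw [mul_assoc]
  gcongr

/-! ### Maximal functions of singular integrals of measures -/

lemma MemM1.add {f g : Euc N → ℝ≥0∞} (hf : MemM1 f) (hg : MemM1 g) :
    MemM1 fun x => f x + g x := by
  refine ⟨hf.1.add hg.1, lt_of_le_of_lt (b := 2 * (weakNorm f + weakNorm g)) ?_ ?_⟩
  · refine iSup₂_le fun t ht => ?_
    have hsub : {x | ENNReal.ofReal t < ‖f x + g x‖ₑ} ⊆
        {x | ENNReal.ofReal (t / 2) < ‖f x‖ₑ} ∪ {x | ENNReal.ofReal (t / 2) < ‖g x‖ₑ} := by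
      intro x hx
      by_contra h
      simp only [mem_union, mem_ofPred_eq, not_or, not_lt] at h
      have hx : ENNReal.ofReal t < ‖f x + g x‖ₑ := hx
      refine absurd hx (not_lt.2 ?_)
      refine (enorm_add_le _ _).trans ((add_le_add h.1 h.2).trans_eq ?_)
      rw [← ENNReal.ofReal_add (by positivity) (by positivity), add_halves]
    have h1 := le_iSup₂ (f := fun (s : ℝ) (_ : 0 < s) =>
      ENNReal.ofReal s * volume {x | ENNReal.ofReal s < ‖f x‖ₑ}) (t / 2) (by positivity)
    have h2 := le_iSup₂ (f := fun (s : ℝ) (_ : 0 < s) =>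
      ENNReal.ofReal s * volume {x | ENNReal.ofReal s < ‖g x‖ₑ}) (t / 2) (by positivity)
    have e : ENNReal.ofReal t = 2 * ENNReal.ofReal (t / 2) := by
      rw [← ENNReal.ofReal_ofNat, ← ENNReal.ofReal_mul (by norm_num)]
      congr 1
      ring
    calc _ ≤ ENNReal.ofReal t * (volume {x | ENNReal.ofReal (t / 2) < ‖f x‖ₑ} +
          volume {x | ENNReal.ofReal (t / 2) < ‖g x‖ₑ}) := by
          gcongr
          exact (measure_mono hsub).trans (measure_union_le _ _)
      _ ≤ _ := by
          rw [e, mul_assoc, mul_add]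
          gcongr
          · exact h1
          · exact h2
  · exact ENNReal.mul_lt_top (by simp) (ENNReal.add_lt_top.2 ⟨hf.2, hg.2⟩)

lemma memM1_zero : MemM1 fun _ : Euc N => (0 : ℝ≥0∞) := by
  refine ⟨aestronglyMeasurable_const, ?_⟩
  simp [weakNorm]

lemma MemM1.sum {ι : Type*} (s : Finset ι) {f : ι → Euc N → ℝ≥0∞} (hf : ∀ i, MemM1 (f i)) :
    MemM1 fun x => ∑ i ∈ s, f i x := by
  classical
  induction s using Finset.induction_on with
  | empty => simpa using memM1_zero
  | insert a s ha ih => simpa [Finset.sum_insert ha] using (hf a).add ih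

lemma MemM1.ae_lt_top {f : Euc N → ℝ≥0∞} (hf : MemM1 f) : volume {x | f x = ⊤} = 0 := by
  have h : ∀ n : ℕ, (n + 1 : ℝ≥0∞) * volume {x | f x = ⊤} ≤ weakNorm f := by
    intro n
    have h1 := le_iSup₂ (f := fun (s : ℝ) (_ : 0 < s) =>
      ENNReal.ofReal s * volume {x | ENNReal.ofReal s < ‖f x‖ₑ}) ((n : ℝ) + 1) (by positivity)
    refine le_trans ?_ h1
    have e : ENNReal.ofReal ((n : ℝ) + 1) = n + 1 := by
      rw [ENNReal.ofReal_add (by positivity) (by positivity)]; simp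
    rw [← e]
    gcongr with x
    intro hx
    rw [hx]
    exact ENNReal.ofReal_lt_top
  by_contra h0
  obtain ⟨n, hn⟩ := ENNReal.exists_nat_mul_gt h0 hf.2.ne
  refine absurd (h n) (not_le.2 (hn.trans_le ?_))
  gcongr
  exact le_self_add

lemma MemM1.toReal {f : Euc N → ℝ≥0∞} (hf : MemM1 f) : MemM1 fun x => (f x).toReal := by
  refine ⟨hf.1.aemeasurable.ennreal_toReal.aestronglyMeasurable, lt_of_le_of_lt ?_ hf.2⟩
  refine iSup₂_mono fun t ht => ?_
  gcongr with x
  rw [Real.enorm_of_nonneg ENNReal.toReal_nonneg]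
  exact ENNReal.ofReal_toReal_le

lemma FundamentalKernel.apply_dilatedAt (K : FundamentalKernel N) (g : SignedMeasure (Euc N))
    (ρ : 𝓓((⊤ : TopologicalSpace.Opens (Euc N)), ℝ)) (ε : Ioi (0 : ℝ)) (x : Euc N) :
    K.apply g (dilatedAt ρ ε x) =
      ∫ y, K.dist (dilatedAt ρ ε (x - y)) ∂g.toJordanDecomposition.posPart -
        ∫ y, K.dist (dilatedAt ρ ε (x - y)) ∂g.toJordanDecomposition.negPart := by
  rw [K.apply_eq, integralSigned]
  simp only [K.reflectedOp_dilatedAt]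

lemma FundamentalKernel.continuous_dist_dilatedAt (K : FundamentalKernel N)
    (ρ : 𝓓((⊤ : TopologicalSpace.Opens (Euc N)), ℝ)) (ε : Ioi (0 : ℝ)) :
    Continuous fun z => K.dist (dilatedAt ρ ε z) := by
  have h := K.norm_dist_dilatedAt_sub_le ρ ε
  refine (LipschitzWith.of_dist_le_mul (K := (2 * Real.pi * ‖K.symbol‖ *
    (∫ ξ, ‖ξ‖ * ‖𝓕 (complexify ρ) ξ‖) / (ε : ℝ) ^ (N + 1)).toNNReal) fun z w => ?_).continuous
  rw [dist_eq_norm, dist_eq_norm]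
  refine (h z w).trans ?_
  gcongr
  exact Real.le_coe_toNNReal _

lemma FundamentalKernel.continuous_apply_dilatedAt (K : FundamentalKernel N)
    (g : SignedMeasure (Euc N)) (ρ : 𝓓((⊤ : TopologicalSpace.Opens (Euc N)), ℝ))
    (ε : Ioi (0 : ℝ)) : Continuous fun x => K.apply g (dilatedAt ρ ε x) := by
  obtain ⟨M, hM⟩ := K.exists_norm_dist_dilatedAt_le ρ ε
  have hc := K.continuous_dist_dilatedAt ρ ε
  have h : ∀ (μ : Measure (Euc N)) [IsFiniteMeasure μ],
      Continuous fun x => ∫ y, K.dist (dilatedAt ρ ε (x - y)) ∂μ := fun μ _ =>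
    continuous_of_dominated (F := fun x y => K.dist (dilatedAt ρ ε (x - y)))
      (bound := fun _ => M)
      (fun x => (hc.comp (continuous_sub_left x)).aestronglyMeasurable)
      (fun x => ae_of_all _ fun y => hM _) (integrable_const M)
      (ae_of_all _ fun y => hc.comp (continuous_sub_right y))
  rw [funext (K.apply_dilatedAt g ρ ε)]
  exact (h _).sub (h _)

/-- The maximal function of `S g` relative to a family of test functions belongs to `M^1`, provided
that the family is bounded, supported in the unit ball, and its Fourier transforms have uniformly
bounded first moments. -/
theorem memM1_maximalFunction (hN : N ≠ 0) (K : FundamentalKernel N) {ι : Type*}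
    {ρ : ι → 𝓓((⊤ : TopologicalSpace.Opens (Euc N)), ℝ)} {R D : ℝ}
    (hρ : ∀ ν w, ρ ν w ≠ 0 → ‖w‖ ≤ 1) (hR : ∀ ν w, |ρ ν w| ≤ R)
    (hD : ∀ ν, ∫ ξ, ‖ξ‖ * ‖𝓕 (complexify (ρ ν)) ξ‖ ≤ D) (g : SignedMeasure (Euc N)) :
    MemM1 (maximalFunction ρ (K.apply g)) := by
  refine ⟨?_, ?_⟩
  · have h : LowerSemicontinuous (maximalFunction ρ (K.apply g)) := by
      refine lowerSemicontinuous_iSup fun ν => lowerSemicontinuous_iSup fun ε => ?_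
      exact (K.continuous_apply_dilatedAt g (ρ ν) ε).enorm.lowerSemicontinuous
    exact h.measurable.aestronglyMeasurable
  obtain ⟨C, hC0, hC⟩ := K.exists_regularity R D
  obtain ⟨A, hA, hweak⟩ := exists_weak_type_maximal hN
    (P := fun (i : ι × Ioi (0 : ℝ)) z => K.dist (dilatedAt (ρ i.1) i.2 z))
    (fun i => K.exists_norm_dist_dilatedAt_le _ _)
    (fun i => ⟨_, by
      have : 0 < (i.2 : ℝ) := i.2.2
      positivity, K.norm_dist_dilatedAt_sub_le _ _⟩)
    ⟨C, hC0, fun i z w => hC _ _ z w (hρ i.1) (hR i.1) (hD i.1)⟩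
    (K.exists_weak_type_two hρ hR)
  set p := g.toJordanDecomposition.posPart with hp
  set n := g.toJordanDecomposition.negPart with hn
  refine lt_of_le_of_lt (b := 2 * (A * p univ + A * n univ)) ?_ (by finiteness)
  refine iSup₂_le fun t ht => ?_
  have hsub : {x | ENNReal.ofReal t < ‖maximalFunction ρ (K.apply g) x‖ₑ} ⊆
      {x | ∃ i : ι × Ioi (0 : ℝ), t / 2 < ‖∫ y, K.dist (dilatedAt (ρ i.1) i.2 (x - y)) ∂p‖} ∪
      {x | ∃ i : ι × Ioi (0 : ℝ), t / 2 < ‖∫ y, K.dist (dilatedAt (ρ i.1) i.2 (x - y)) ∂n‖} := by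
    intro x hx
    by_contra h
    simp only [mem_union, mem_ofPred_eq, not_or, not_exists, not_lt] at h
    have hx : ENNReal.ofReal t < ‖maximalFunction ρ (K.apply g) x‖ₑ := hx
    refine absurd hx (not_lt.2 ?_)
    rw [enorm_eq_self]
    refine iSup₂_le fun ν ε => ?_
    rw [K.apply_dilatedAt, ← ofReal_norm]
    refine ENNReal.ofReal_le_ofReal ((norm_sub_le _ _).trans ?_)
    linarith [h.1 (ν, ε), h.2 (ν, ε)]
  have e : ENNReal.ofReal t = 2 * ENNReal.ofReal (t / 2) := by
    rw [← ENNReal.ofReal_ofNat, ← ENNReal.ofReal_mul (by norm_num)]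
    congr 1
    ring
  have hvol := (measure_mono (μ := volume) hsub).trans (measure_union_le _ _)
  refine (mul_le_mul_right hvol _).trans ?_
  rw [e, mul_assoc, mul_add]
  exact mul_le_mul_right (add_le_add (hweak p (t / 2) (by positivity))
    (hweak n (t / 2) (by positivity))) _

/-! ### The kernels `Υ^{ξ,j}` -/

lemma upsilon_apply (h : 𝓓((⊤ : TopologicalSpace.Opens (Euc N)), ℝ)) (j : Fin N)
    (ξ : Metric.sphere (0 : Euc N) 1) (w : Euc N) :
    upsilon h j ξ w = h ((1 / 2 : ℝ) • (ξ : Euc N) - w) * w j := rfl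

lemma abs_coord_le_norm (w : Euc N) (j : Fin N) : |w j| ≤ ‖w‖ := PiLp.norm_apply_le w j

lemma norm_lt_one_of_upsilon_ne_zero {h : 𝓓((⊤ : TopologicalSpace.Opens (Euc N)), ℝ)}
    (hh : tsupport h ⊆ Metric.ball 0 (1 / 2)) {ξ : Metric.sphere (0 : Euc N) 1} {w : Euc N}
    (hw : h ((1 / 2 : ℝ) • (ξ : Euc N) - w) ≠ 0) : ‖w‖ < 1 := by
  have h1 := hh (subset_tsupport _ hw)
  rw [mem_ball_zero_iff] at h1
  have h2 : ‖(ξ : Euc N)‖ = 1 := by simp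
  have h3 : w = (1 / 2 : ℝ) • (ξ : Euc N) - ((1 / 2 : ℝ) • (ξ : Euc N) - w) := by abel
  have h4 : ‖(1 / 2 : ℝ) • (ξ : Euc N)‖ = 1 / 2 := by
    rw [norm_smul, h2]; norm_num
  calc ‖w‖ = ‖(1 / 2 : ℝ) • (ξ : Euc N) - ((1 / 2 : ℝ) • (ξ : Euc N) - w)‖ := by rw [← h3]
    _ ≤ ‖(1 / 2 : ℝ) • (ξ : Euc N)‖ + ‖(1 / 2 : ℝ) • (ξ : Euc N) - w‖ := norm_sub_le _ _
    _ < 1 := by linarith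

lemma exists_abs_upsilon_le {h : 𝓓((⊤ : TopologicalSpace.Opens (Euc N)), ℝ)}
    (hh : tsupport h ⊆ Metric.ball 0 (1 / 2)) :
    ∃ R : ℝ, ∀ (j : Fin N) (ξ : Metric.sphere (0 : Euc N) 1) w, |upsilon h j ξ w| ≤ R := by
  obtain ⟨R, hR⟩ := h.contDiff.continuous.bounded_above_of_compact_support h.hasCompactSupport
  refine ⟨R, fun j ξ w => ?_⟩
  rw [upsilon_apply]
  by_cases hw : h ((1 / 2 : ℝ) • (ξ : Euc N) - w) = 0
  · rw [hw, zero_mul, abs_zero]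
    exact (norm_nonneg _).trans (hR 0)
  · rw [abs_mul]
    have h1 : |w j| ≤ 1 :=
      (abs_coord_le_norm w j).trans (norm_lt_one_of_upsilon_ne_zero hh hw).le
    calc _ ≤ R * 1 := by
          have := hR ((1 / 2 : ℝ) • (ξ : Euc N) - w)
          rw [Real.norm_eq_abs] at this
          have h2 := (abs_nonneg _).trans this
          gcongr
      _ = R := mul_one R

/-- The function `a ↦ h(a) a_j` as a Schwartz function. -/
def coordMul (h : 𝓓((⊤ : TopologicalSpace.Opens (Euc N)), ℝ)) (j : Fin N) : 𝓢(Euc N, ℂ) :=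
  HasCompactSupport.toSchwartzMap (f := fun y => ((h y * y j : ℝ) : ℂ))
    (h.hasCompactSupport.mul_right.comp_left Complex.ofReal_zero)
    (Complex.ofRealCLM.contDiff.comp (h.contDiff.mul (by fun_prop)))

lemma coordMul_apply (h : 𝓓((⊤ : TopologicalSpace.Opens (Euc N)), ℝ)) (j : Fin N) (a : Euc N) :
    coordMul h j a = ((h a * a j : ℝ) : ℂ) := rfl

/-- The substitution `w = ξ / 2 - a` bounds the Fourier transform of `Υ^{ξ,j}` independently
of `ξ`. -/
lemma norm_fourier_upsilon_le (h : 𝓓((⊤ : TopologicalSpace.Opens (Euc N)), ℝ)) (j : Fin N)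
    (ξ : Metric.sphere (0 : Euc N) 1) (η : Euc N) :
    ‖𝓕 (complexify (upsilon h j ξ)) η‖ ≤ ‖𝓕⁻ (complexify h) η‖ + ‖𝓕⁻ (coordMul h j) η‖ := by
  set b := (1 / 2 : ℝ) • (ξ : Euc N) with hb
  have hbj : |b j| ≤ 1 := by
    have h2 : ‖(ξ : Euc N)‖ = 1 := by simp
    refine (abs_coord_le_norm b j).trans ?_
    rw [hb, norm_smul, h2]
    norm_num
  have hI : ∀ φ : 𝓢(Euc N, ℂ), Integrable fun a => (Real.fourierChar (inner ℝ a η) : ℂ) * φ a := by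
    intro φ
    have := (Real.fourierIntegral_convergent_iff (μ := volume) (-η)).2 φ.integrable
    simpa [Circle.smul_def] using this
  have key : 𝓕 (complexify (upsilon h j ξ)) η = (Real.fourierChar (-inner ℝ b η) : ℂ) *
      ((b j : ℂ) * 𝓕⁻ (complexify h) η - 𝓕⁻ (coordMul h j) η) := by
    rw [SchwartzMap.fourier_coe, Real.fourier_eq, SchwartzMap.fourierInv_coe, Real.fourierInv_eq,
      SchwartzMap.fourierInv_coe, Real.fourierInv_eq]
    simp only [Circle.smul_def, smul_eq_mul]
    rw [← integral_const_mul, ← integral_sub ((hI _).const_mul _) (hI _), ← integral_const_mul,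
      ← integral_sub_left_eq_self _ volume b]
    congr 1 with a
    have e : Real.fourierChar (-inner ℝ (b - a) η) =
        Real.fourierChar (-inner ℝ b η) * Real.fourierChar (inner ℝ a η) := by
      rw [inner_sub_left, neg_sub, sub_eq_add_neg, AddChar.map_add_eq_mul, mul_comm]
    rw [e, complexify_apply, complexify_apply, upsilon_apply, coordMul_apply, ← hb, sub_sub_cancel]
    simp only [PiLp.sub_apply, Circle.coe_mul]
    push_cast
    ring
  rw [key, norm_mul, Circle.norm_coe, one_mul]
  refine (norm_sub_le _ _).trans ?_
  gcongr
  rw [norm_mul, Complex.norm_real, Real.norm_eq_abs]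
  exact mul_le_of_le_one_left (norm_nonneg _) hbj

lemma exists_integral_fourier_upsilon_le (h : 𝓓((⊤ : TopologicalSpace.Opens (Euc N)), ℝ))
    (j : Fin N) : ∃ D : ℝ, ∀ ξ : Metric.sphere (0 : Euc N) 1,
      ∫ η, ‖η‖ * ‖𝓕 (complexify (upsilon h j ξ)) η‖ ≤ D := by
  have hI : ∀ φ : 𝓢(Euc N, ℂ), Integrable fun η => ‖η‖ * ‖φ η‖ := fun φ => by
    simpa using φ.integrable_pow_mul volume 1
  refine ⟨∫ η, (‖η‖ * ‖𝓕⁻ (complexify h) η‖ + ‖η‖ * ‖𝓕⁻ (coordMul h j) η‖), fun ξ => ?_⟩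
  refine integral_mono (hI _) ((hI _).add (hI _)) fun η => ?_
  simp only [← mul_add]
  gcongr
  exact norm_fourier_upsilon_le h j ξ η

theorem memM1_explicitU (hN : N ≠ 0) {m : ℕ} {h : 𝓓((⊤ : TopologicalSpace.Opens (Euc N)), ℝ)}
    (hh : tsupport h ⊆ Metric.ball 0 (1 / 2)) (S : Fin N → Fin m → FundamentalKernel N)
    (g : Fin N → Fin m → SignedMeasure (Euc N)) : MemM1 (explicitU h S g) := by
  obtain ⟨R, hR⟩ := exists_abs_upsilon_le hh
  refine MemM1.sum _ fun j => MemM1.sum _ fun k => ?_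
  obtain ⟨D, hD⟩ := exists_integral_fourier_upsilon_le h j
  refine memM1_maximalFunction hN (S j k) (fun ξ w hw => ?_) (hR j) hD (g j k)
  exact (norm_lt_one_of_upsilon_ne_zero hh (left_ne_zero_of_mul hw)).le

/-! ### Mollification along a direction -/

/-- The kernel `y ↦ ε^{-N} h(ξ/2 - (x - y)/ε)`: the mollifier `h`, scaled by `ε` and centred at
`x - ε ξ / 2`. -/
def shiftedBump (h : 𝓓((⊤ : TopologicalSpace.Opens (Euc N)), ℝ))
    (ξ : Metric.sphere (0 : Euc N) 1) (x : Euc N) (ε : ℝ) (y : Euc N) : ℝ :=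
  (ε ^ N)⁻¹ * h ((1 / 2 : ℝ) • (ξ : Euc N) - ε⁻¹ • (x - y))

/-- The derivative of `shiftedBump` with respect to the scale `ε`. -/
def shiftedBumpDeriv (h : 𝓓((⊤ : TopologicalSpace.Opens (Euc N)), ℝ))
    (ξ : Metric.sphere (0 : Euc N) 1) (x : Euc N) (ε : ℝ) (y : Euc N) : ℝ :=
  (ε ^ (N + 1))⁻¹ * (fderiv ℝ h ((1 / 2 : ℝ) • (ξ : Euc N) - ε⁻¹ • (x - y)) (ε⁻¹ • (x - y)) -
    N * h ((1 / 2 : ℝ) • (ξ : Euc N) - ε⁻¹ • (x - y)))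

variable {h : 𝓓((⊤ : TopologicalSpace.Opens (Euc N)), ℝ)} {ξ : Metric.sphere (0 : Euc N) 1}
  {x : Euc N}

lemma differentiable_testFunction (h : 𝓓((⊤ : TopologicalSpace.Opens (Euc N)), ℝ)) :
    Differentiable ℝ h := by
  have : ContDiff ℝ ∞ h := h.contDiff
  exact this.differentiable (by simp)

lemma continuous_fderiv_testFunction (h : 𝓓((⊤ : TopologicalSpace.Opens (Euc N)), ℝ)) :
    Continuous (fderiv ℝ h) := by
  have : ContDiff ℝ ∞ h := h.contDiff
  exact this.continuous_fderiv (by simp)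

lemma hasDerivAt_shiftedBump {ε : ℝ} (hε : 0 < ε) (y : Euc N) :
    HasDerivAt (fun ε => shiftedBump h ξ x ε y) (shiftedBumpDeriv h ξ x ε y) ε := by
  have h1 : HasDerivAt (fun ε : ℝ => (ε ^ N)⁻¹) (-(N * ε ^ (N - 1)) / (ε ^ N) ^ 2) ε :=
    (hasDerivAt_pow N ε).inv (by positivity)
  have h2 : HasDerivAt (fun ε : ℝ => (1 / 2 : ℝ) • (ξ : Euc N) - ε⁻¹ • (x - y))
      (-((-(ε ^ 2)⁻¹) • (x - y))) ε :=
    ((hasDerivAt_inv hε.ne').smul_const (x - y)).const_sub _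
  have h3 := (differentiable_testFunction h
    ((1 / 2 : ℝ) • (ξ : Euc N) - ε⁻¹ • (x - y))).hasFDerivAt.comp_hasDerivAt ε h2
  refine (h1.mul h3).congr_deriv ?_
  rw [shiftedBumpDeriv, neg_smul, neg_neg, map_smul, map_smul]
  simp only [smul_eq_mul, Function.comp_apply]
  rcases N with _ | n
  · simp
    field_simp
  · simp only [Nat.add_sub_cancel]
    field_simp
    ring

/-- The derivative of `shiftedBump` with respect to the scale is the divergence of the vector field
with components `Υ^{ξ,j}_ε(x - ·)`. -/
lemma sum_fderiv_dilatedAt_upsilon (ε : Ioi (0 : ℝ)) (y : Euc N) :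
    ∑ j, fderiv ℝ (dilatedAt (upsilon h j ξ) ε x) y (EuclideanSpace.single j 1) =
      shiftedBumpDeriv h ξ x ε y := by
  have hε : 0 < (ε : ℝ) := ε.2
  set p := (1 / 2 : ℝ) • (ξ : Euc N) - (ε : ℝ)⁻¹ • (x - y) with hp
  set e : Fin N → Euc N := fun j => EuclideanSpace.single j 1 with he
  have hpart : ∀ j, fderiv ℝ (dilatedAt (upsilon h j ξ) ε x) y (e j) =
      ((((ε : ℝ) ^ (N + 1))⁻¹ *
        (((ε : ℝ)⁻¹ • (x - y)) j * fderiv ℝ h p (e j) - h p) : ℝ) : ℂ) := by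
    intro j
    have hline : ∀ c : Euc N, HasDerivAt (fun t : ℝ => (ε : ℝ)⁻¹ • (c - (y + t • e j)))
        (-((ε : ℝ)⁻¹ • e j)) 0 := by
      intro c
      have h1 : HasDerivAt (fun t : ℝ => t • e j) ((1 : ℝ) • e j) 0 :=
        (hasDerivAt_id (0 : ℝ)).smul_const (e j)
      rw [one_smul] at h1
      have h2 := ((h1.const_add y).const_sub c).const_smul (ε : ℝ)⁻¹
      rwa [smul_neg] at h2
    have hA : HasDerivAt (fun t : ℝ => h ((1 / 2 : ℝ) • (ξ : Euc N) -
        (ε : ℝ)⁻¹ • (x - (y + t • e j)))) ((ε : ℝ)⁻¹ * fderiv ℝ h p (e j)) 0 := by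
      have h1 := (hline x).const_sub ((1 / 2 : ℝ) • (ξ : Euc N))
      rw [neg_neg] at h1
      have h2 : HasFDerivAt h (fderiv ℝ h p) ((1 / 2 : ℝ) • (ξ : Euc N) -
          (ε : ℝ)⁻¹ • (x - (y + (0 : ℝ) • e j))) := by
        rw [zero_smul, add_zero]
        exact (differentiable_testFunction h p).hasFDerivAt
      have h3 := h2.comp_hasDerivAt (0 : ℝ) h1
      rwa [map_smul, smul_eq_mul] at h3
    have hB : HasDerivAt (fun t : ℝ => ((ε : ℝ)⁻¹ • (x - (y + t • e j))) j) (-(ε : ℝ)⁻¹) 0 := by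
      have h1 := (EuclideanSpace.proj j : Euc N →L[ℝ] ℝ).hasFDerivAt.comp_hasDerivAt
        (0 : ℝ) (hline x)
      refine h1.congr_deriv ?_
      simp [he]
    have hC : HasDerivAt (fun t : ℝ => dilatedAt (upsilon h j ξ) ε x (y + t • e j))
        ((((ε : ℝ) ^ (N + 1))⁻¹ *
          (((ε : ℝ)⁻¹ • (x - y)) j * fderiv ℝ h p (e j) - h p) : ℝ) : ℂ) 0 := by
      have h1 := ((hA.mul hB).const_mul ((ε : ℝ) ^ N)⁻¹).ofReal_comp
      refine h1.congr_deriv ?_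
      simp only [zero_smul, add_zero]
      rw [← hp]
      congr 1
      field_simp
      ring
    have hdiff : DifferentiableAt ℝ (dilatedAt (upsilon h j ξ) ε x) y :=
      (dilatedAt (upsilon h j ξ) ε x).differentiableAt
    have hD := hdiff.hasFDerivAt.hasLineDerivAt (e j)
    exact hD.unique hC
  refine (Finset.sum_congr rfl fun j _ => hpart j).trans ?_
  rw [← Complex.ofReal_sum, shiftedBumpDeriv, ← hp, ← Finset.mul_sum, Finset.sum_sub_distrib,
    Finset.sum_const, Finset.card_univ, Fintype.card_fin, nsmul_eq_mul]
  congr 4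
  have hz : ∑ j, ((ε : ℝ)⁻¹ • (x - y)) j • e j = (ε : ℝ)⁻¹ • (x - y) := by
    simpa using (EuclideanSpace.basisFun (Fin N) ℝ).sum_repr ((ε : ℝ)⁻¹ • (x - y))
  conv_rhs => rw [← hz, map_sum]
  simp only [map_smul, smul_eq_mul]

lemma norm_le_of_mem_tsupport (hh : tsupport h ⊆ Metric.ball 0 (1 / 2)) {ε : ℝ} (hε : 0 < ε)
    {y : Euc N} (hy : (1 / 2 : ℝ) • (ξ : Euc N) - ε⁻¹ • (x - y) ∈ tsupport h) :
    ‖ε⁻¹ • (x - y)‖ ≤ 1 ∧ y ∈ Metric.closedBall x ε := by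
  have h1 := hh hy
  rw [mem_ball_zero_iff] at h1
  have h2 : ‖(ξ : Euc N)‖ = 1 := by simp
  have h4 : ‖(1 / 2 : ℝ) • (ξ : Euc N)‖ = 1 / 2 := by
    rw [norm_smul, h2]; norm_num
  have h3 : ‖ε⁻¹ • (x - y)‖ ≤ 1 := by
    set w := ε⁻¹ • (x - y)
    have h5 : w = (1 / 2 : ℝ) • (ξ : Euc N) - ((1 / 2 : ℝ) • (ξ : Euc N) - w) := by abel
    rw [h5]
    exact (norm_sub_le _ _).trans (by linarith)
  refine ⟨h3, ?_⟩
  rw [norm_smul, norm_inv, Real.norm_of_nonneg hε.le, inv_mul_le_iff₀ hε, mul_one,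
    norm_sub_rev] at h3
  rwa [Metric.mem_closedBall, dist_eq_norm]

lemma shiftedBump_eq_zero (hh : tsupport h ⊆ Metric.ball 0 (1 / 2)) {ε : ℝ} (hε : 0 < ε)
    {y : Euc N} (hy : y ∉ Metric.closedBall x ε) : shiftedBump h ξ x ε y = 0 := by
  have h1 : (1 / 2 : ℝ) • (ξ : Euc N) - ε⁻¹ • (x - y) ∉ tsupport h := fun h2 =>
    hy (norm_le_of_mem_tsupport hh hε h2).2
  rw [shiftedBump, image_eq_zero_of_notMem_tsupport h1, mul_zero]

lemma continuous_shiftedBump (ε : ℝ) : Continuous (shiftedBump h ξ x ε) := by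
  have := h.contDiff.continuous
  unfold shiftedBump
  fun_prop

lemma continuous_shiftedBumpDeriv (ε : ℝ) : Continuous (shiftedBumpDeriv h ξ x ε) := by
  have h1 := h.contDiff.continuous
  have h2 := continuous_fderiv_testFunction h
  unfold shiftedBumpDeriv
  have h3 : Continuous fun y => fderiv ℝ h ((1 / 2 : ℝ) • (ξ : Euc N) - ε⁻¹ • (x - y))
      (ε⁻¹ • (x - y)) := (h2.comp (by fun_prop)).clm_apply (by fun_prop)
  fun_prop

/-- Near a positive scale, the derivative of `shiftedBump` with respect to the scale is bounded,
and supported in a fixed ball. -/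
lemma exists_abs_shiftedBumpDeriv_le (hh : tsupport h ⊆ Metric.ball 0 (1 / 2)) {ε₀ : ℝ}
    (hε₀ : 0 < ε₀) : ∃ C : ℝ, ∀ ε ∈ Ioo (ε₀ / 2) (2 * ε₀), ∀ y,
      |shiftedBumpDeriv h ξ x ε y| ≤ (Metric.closedBall x (2 * ε₀)).indicator (fun _ => C) y := by
  obtain ⟨A, hA⟩ := h.contDiff.continuous.bounded_above_of_compact_support h.hasCompactSupport
  obtain ⟨A', hA'⟩ := (continuous_fderiv_testFunction h).bounded_above_of_compact_support
    (h.hasCompactSupport.fderiv (𝕜 := ℝ))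
  have hA0 : 0 ≤ A := (norm_nonneg _).trans (hA 0)
  have hA'0 : 0 ≤ A' := (norm_nonneg _).trans (hA' 0)
  refine ⟨((ε₀ / 2) ^ (N + 1))⁻¹ * (A' * 1 + N * A), fun ε hε y => ?_⟩
  have hε0 : 0 < ε := lt_trans (by positivity) hε.1
  rw [shiftedBumpDeriv]
  set p := (1 / 2 : ℝ) • (ξ : Euc N) - ε⁻¹ • (x - y) with hp
  by_cases hps : p ∈ tsupport h
  · obtain ⟨h1, h2⟩ := norm_le_of_mem_tsupport hh hε0 hps
    rw [indicator_of_mem (Metric.closedBall_subset_closedBall hε.2.le h2), abs_mul,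
      abs_of_pos (by positivity)]
    gcongr
    · exact hε.1.le
    · refine (abs_sub _ _).trans (add_le_add ?_ ?_)
      · refine ((fderiv ℝ h p).le_opNorm _).trans ?_
        gcongr
        exact hA' p
      · rw [abs_mul, Nat.abs_cast]
        gcongr
        exact hA p
  · rw [image_eq_zero_of_notMem_tsupport hps, fderiv_of_notMem_tsupport ℝ hps]
    simp only [zero_apply, mul_zero, sub_zero, abs_zero]
    exact indicator_nonneg (fun _ _ => by positivity) y

lemma integrable_mul_shiftedBump {u : Euc N → ℝ} (hu : LocallyIntegrable u volume)
    (hh : tsupport h ⊆ Metric.ball 0 (1 / 2)) {ε : ℝ} (hε : 0 < ε) :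
    Integrable fun y => u y * shiftedBump h ξ x ε y := by
  have hcs : HasCompactSupport (shiftedBump h ξ x ε) :=
    HasCompactSupport.of_support_subset_isCompact (isCompact_closedBall x ε) fun y hy => by
      by_contra h1
      exact hy (shiftedBump_eq_zero hh hε h1)
  simpa [mul_comm] using hu.integrable_smul_left_of_hasCompactSupport (continuous_shiftedBump ε) hcs

/-- The derivative of the mollification of `u` with respect to the scale. -/
lemma hasDerivAt_integral_mul_shiftedBump {u : Euc N → ℝ} (hu : LocallyIntegrable u volume)
    (hh : tsupport h ⊆ Metric.ball 0 (1 / 2)) {ε : ℝ} (hε : 0 < ε) :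
    HasDerivAt (fun ε => ∫ y, u y * shiftedBump h ξ x ε y)
      (∫ y, u y * shiftedBumpDeriv h ξ x ε y) ε := by
  obtain ⟨C, hC⟩ := exists_abs_shiftedBumpDeriv_le (ξ := ξ) (x := x) hh hε
  have hs : Ioo (ε / 2) (2 * ε) ∈ 𝓝 ε := Ioo_mem_nhds (by linarith) (by linarith)
  have hum : AEStronglyMeasurable u volume := hu.aestronglyMeasurable
  refine (hasDerivAt_integral_of_dominated_loc_of_deriv_le
    (F := fun ε y => u y * shiftedBump h ξ x ε y)
    (F' := fun ε y => u y * shiftedBumpDeriv h ξ x ε y)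
    (bound := (Metric.closedBall x (2 * ε)).indicator fun y => ‖u y‖ * C) hs
    (Eventually.of_forall fun δ => hum.mul (continuous_shiftedBump δ).aestronglyMeasurable)
    (integrable_mul_shiftedBump hu hh hε)
    (hum.mul (continuous_shiftedBumpDeriv ε).aestronglyMeasurable)
    (ae_of_all _ fun y δ hδ => ?_) ?_ (ae_of_all _ fun y δ hδ => ?_)).2
  · rw [norm_mul]
    have := hC δ hδ y
    by_cases hy : y ∈ Metric.closedBall x (2 * ε)
    · rw [indicator_of_mem hy] at this ⊢
      exact mul_le_mul_of_nonneg_left this (norm_nonneg _)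
    · rw [indicator_of_notMem hy] at this ⊢
      rw [Real.norm_eq_abs (shiftedBumpDeriv h ξ x δ y), le_antisymm this (abs_nonneg _), mul_zero]
  · rw [integrable_indicator_iff Metric.isClosed_closedBall.measurableSet]
    exact ((hu.integrableOn_isCompact (isCompact_closedBall x (2 * ε))).norm.mul_const C)
  · exact (hasDerivAt_shiftedBump (lt_trans (by positivity) hδ.1) y).const_mul _

/-- The derivative of the mollification of `u` with respect to the scale, in terms of the
distributional gradient of `u`. -/
lemma ofReal_integral_mul_shiftedBumpDeriv {u : Euc N → ℝ} (hu : LocallyIntegrable u volume)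
    {T : Fin N → 𝓢'(Euc N, ℂ)} (hT : ∀ j, HasDistribPartial u j (T j)) (ε : Ioi (0 : ℝ)) :
    ((∫ y, u y * shiftedBumpDeriv h ξ x ε y : ℝ) : ℂ) =
      -∑ j, T j (dilatedAt (upsilon h j ξ) ε x) := by
  have hcs : ∀ j, HasCompactSupport (dilatedAt (upsilon h j ξ) ε x) := by
    intro j
    have hε' : (ε : ℝ)⁻¹ ≠ 0 := inv_ne_zero (ne_of_gt ε.2)
    let e : Euc N ≃ₜ Euc N := (Homeomorph.subLeft x).trans (Homeomorph.smulOfNeZero _ hε')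
    have h1 : HasCompactSupport fun y => upsilon h j ξ ((ε : ℝ)⁻¹ • (x - y)) :=
      (upsilon h j ξ).hasCompactSupport.comp_homeomorph e
    exact (h1.mul_left (f := fun _ => ((ε : ℝ) ^ N)⁻¹)).comp_left Complex.ofReal_zero
  have hI : ∀ j, Integrable fun y => (u y : ℂ) *
      fderiv ℝ (dilatedAt (upsilon h j ξ) ε x) y (EuclideanSpace.single j 1) := by
    intro j
    have hd : Continuous fun y =>
        fderiv ℝ (dilatedAt (upsilon h j ξ) ε x) y (EuclideanSpace.single j 1) :=
      (((dilatedAt (upsilon h j ξ) ε x).smooth ⊤).continuous_fderiv (by simp)).clm_apply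
        continuous_const
    have hdc : HasCompactSupport fun y =>
        fderiv ℝ (dilatedAt (upsilon h j ξ) ε x) y (EuclideanSpace.single j 1) :=
      (hcs j).fderiv_apply (𝕜 := ℝ) _
    have := hu.integrable_smul_right_of_hasCompactSupport hd hdc
    simpa [Complex.real_smul] using this
  rw [← integral_complex_ofReal, ← Finset.sum_neg_distrib]
  have h1 : ∀ j, -T j (dilatedAt (upsilon h j ξ) ε x) = ∫ y, (u y : ℂ) *
      fderiv ℝ (dilatedAt (upsilon h j ξ) ε x) y (EuclideanSpace.single j 1) := fun j => by
    rw [← hT j _ (hcs j), neg_neg]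
  simp only [h1]
  rw [← integral_finsetSum _ fun j _ => hI j]
  congr 1 with y
  rw [← Finset.mul_sum, sum_fderiv_dilatedAt_upsilon]
  push_cast
  rfl

/-- The mollifications of `u` converge at its Lebesgue points. -/
lemma tendsto_integral_mul_shiftedBump {u : Euc N → ℝ} (hu : LocallyIntegrable u volume)
    (h1 : ∫ y, h y = 1) (hh : tsupport h ⊆ Metric.ball 0 (1 / 2))
    (hx : Tendsto (fun ε : ℝ => ⨍ y in Metric.closedBall x ε, ‖u y - u x‖) (𝓝[>] 0) (𝓝 0)) :
    Tendsto (fun ε : ℝ => ∫ y, u y * shiftedBump h ξ x ε y) (𝓝[>] 0) (𝓝 (u x)) := by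
  obtain ⟨A, hA⟩ := h.contDiff.continuous.bounded_above_of_compact_support h.hasCompactSupport
  have hA0 : 0 ≤ A := (norm_nonneg _).trans (hA 0)
  set v := volume.real (Metric.closedBall (0 : Euc N) 1) with hv
  have hint1 : ∀ ε : ℝ, 0 < ε → ∫ y, shiftedBump h ξ x ε y = 1 := by
    intro ε hε
    simp only [shiftedBump]
    rw [integral_const_mul, integral_sub_left_eq_self
      (fun y => h ((1 / 2 : ℝ) • (ξ : Euc N) - ε⁻¹ • y)) volume x,
      Measure.integral_comp_inv_smul_of_nonneg volume
      (fun y => h ((1 / 2 : ℝ) • (ξ : Euc N) - y)) hε.le, integral_sub_left_eq_self, h1]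
    simp only [finrank_euclideanSpace, Fintype.card_fin, smul_eq_mul, mul_one]
    exact inv_mul_cancel₀ (by positivity)
  rw [tendsto_iff_norm_sub_tendsto_zero]
  have hlim := hx.const_mul (A * v)
  rw [mul_zero] at hlim
  refine squeeze_zero' (Eventually.of_forall fun _ => norm_nonneg _) ?_ hlim
  filter_upwards [self_mem_nhdsWithin] with ε hε
  have hε : 0 < ε := hε
  have hb : Integrable (shiftedBump h ξ x ε) := by
    have := integrable_mul_shiftedBump (u := fun _ => 1) (ξ := ξ) (x := x)
      (locallyIntegrable_const 1) hh hε
    simpa using this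
  have hI := integrable_mul_shiftedBump (ξ := ξ) (x := x) hu hh hε
  have e1 : (∫ y, u y * shiftedBump h ξ x ε y) - u x =
      ∫ y in Metric.closedBall x ε, (u y - u x) * shiftedBump h ξ x ε y := by
    rw [setIntegral_eq_integral_of_forall_compl_eq_zero fun y hy => by
      rw [shiftedBump_eq_zero hh hε hy, mul_zero]]
    simp only [sub_mul]
    rw [integral_sub hI (hb.const_mul _), integral_const_mul, hint1 ε hε, mul_one]
  have hvol : volume.real (Metric.closedBall x ε) = ε ^ N * v := by
    rw [hv, Measure.real, Measure.real, Measure.addHaar_closedBall _ _ hε.le,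
      Measure.addHaar_unitClosedBall_eq_addHaar_unitBall, ENNReal.toReal_mul,
      ENNReal.toReal_ofReal (by positivity)]
    simp
  have huI : IntegrableOn (fun y => ‖u y - u x‖) (Metric.closedBall x ε) :=
    ((hu.integrableOn_isCompact (isCompact_closedBall x ε)).sub
      (integrableOn_const measure_closedBall_lt_top.ne)).norm
  have hv0 : 0 < v := ENNReal.toReal_pos (Metric.measure_closedBall_pos _ _ one_pos).ne'
    measure_closedBall_lt_top.ne
  rw [e1]
  refine (norm_integral_le_of_norm_le (huI.const_mul ((ε ^ N)⁻¹ * A))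
    (ae_of_all _ fun y => ?_)).trans_eq ?_
  · rw [norm_mul, mul_comm]
    gcongr
    rw [shiftedBump, norm_mul, Real.norm_of_nonneg (by positivity)]
    gcongr
    exact hA _
  · rw [integral_const_mul, setAverage_eq, hvol, smul_eq_mul]
    field_simp

/-- At a Lebesgue point `x`, the mollification of `u` at scale `r` differs from `u x` by at most
`r * U x`. -/
lemma abs_integral_mul_shiftedBump_sub_le {m : ℕ} {u : Euc N → ℝ}
    (hu : LocallyIntegrable u volume) {S : Fin N → Fin m → FundamentalKernel N}
    {g : Fin N → Fin m → SignedMeasure (Euc N)}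
    (hder : ∀ j : Fin N, HasDistribPartial u j (∑ k, (S j k).apply (g j k)))
    (h1 : ∫ y, h y = 1) (hh : tsupport h ⊆ Metric.ball 0 (1 / 2))
    (hx : Tendsto (fun ε : ℝ => ⨍ y in Metric.closedBall x ε, ‖u y - u x‖) (𝓝[>] 0) (𝓝 0))
    (hU : explicitU h S g x < ⊤) {r : ℝ} (hr : 0 < r) :
    |(∫ y, u y * shiftedBump h ξ x r y) - u x| ≤ r * (explicitU h S g x).toReal := by
  set U := (explicitU h S g x).toReal with hUdef
  have hbound : ∀ ε ∈ Ioi (0 : ℝ), ‖∫ y, u y * shiftedBumpDeriv h ξ x ε y‖ ≤ U := by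
    intro ε hε
    have e := ofReal_integral_mul_shiftedBumpDeriv (h := h) (ξ := ξ) (x := x) hu hder ⟨ε, hε⟩
    rw [← Complex.norm_real, e, norm_neg, hUdef, ← toReal_enorm]
    refine ENNReal.toReal_mono hU.ne ?_
    refine (enorm_sum_le _ _).trans ?_
    rw [explicitU]
    refine Finset.sum_le_sum fun j _ => ?_
    have e2 : (∑ k, (S j k).apply (g j k)) (dilatedAt (upsilon h j ξ) ⟨ε, hε⟩ x) =
        ∑ k, (S j k).apply (g j k) (dilatedAt (upsilon h j ξ) ⟨ε, hε⟩ x) := by simp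
    rw [e2]
    refine (enorm_sum_le _ _).trans (Finset.sum_le_sum fun k _ => ?_)
    exact le_iSup₂ (f := fun (ν : Metric.sphere (0 : Euc N) 1) (δ : Ioi (0 : ℝ)) =>
      ‖(S j k).apply (g j k) (dilatedAt (upsilon h j ν) δ x)‖ₑ) ξ ⟨ε, hε⟩
  have hmv : ∀ δ ∈ Ioi (0 : ℝ), ‖(∫ y, u y * shiftedBump h ξ x r y) -
      ∫ y, u y * shiftedBump h ξ x δ y‖ ≤ U * ‖r - δ‖ := fun δ hδ =>
    Convex.norm_image_sub_le_of_norm_hasDerivWithin_le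
      (f := fun ε => ∫ y, u y * shiftedBump h ξ x ε y)
      (fun ε hε => (hasDerivAt_integral_mul_shiftedBump hu hh hε).hasDerivWithinAt)
      hbound (convex_Ioi 0) hδ hr
  have hlim := tendsto_integral_mul_shiftedBump (ξ := ξ) hu h1 hh hx
  have hl1 := (hlim.const_sub (∫ y, u y * shiftedBump h ξ x r y)).norm
  have hl2 : Tendsto (fun δ : ℝ => U * ‖r - δ‖) (𝓝[>] 0) (𝓝 (U * ‖r - 0‖)) := by
    refine Tendsto.mono_left ?_ nhdsWithin_le_nhds
    exact (Continuous.tendsto (by fun_prop) 0)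
  have := le_of_tendsto_of_tendsto hl1 hl2 (by
    filter_upwards [self_mem_nhdsWithin] with δ hδ using hmv δ hδ)
  rwa [sub_zero, Real.norm_of_nonneg hr.le, mul_comm] at this

/-- The estimate of difference quotients at Lebesgue points: the mollifications of `u` at `x` and
at `y` at scale `‖x - y‖`, in the directions pointing at each other, coincide. -/
lemma abs_sub_le_mul_explicitU {m : ℕ} {u : Euc N → ℝ}
    (hu : LocallyIntegrable u volume) {S : Fin N → Fin m → FundamentalKernel N}
    {g : Fin N → Fin m → SignedMeasure (Euc N)}
    (hder : ∀ j : Fin N, HasDistribPartial u j (∑ k, (S j k).apply (g j k)))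
    (h1 : ∫ y, h y = 1) (hh : tsupport h ⊆ Metric.ball 0 (1 / 2)) {x y : Euc N}
    (hx : Tendsto (fun ε : ℝ => ⨍ z in Metric.closedBall x ε, ‖u z - u x‖) (𝓝[>] 0) (𝓝 0))
    (hy : Tendsto (fun ε : ℝ => ⨍ z in Metric.closedBall y ε, ‖u z - u y‖) (𝓝[>] 0) (𝓝 0))
    (hUx : explicitU h S g x < ⊤) (hUy : explicitU h S g y < ⊤) :
    |u x - u y| ≤ ‖x - y‖ * ((explicitU h S g x).toReal + (explicitU h S g y).toReal) := by
  rcases eq_or_ne x y with rfl | hxy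
  · simp
  have hr : 0 < ‖x - y‖ := norm_pos_iff.2 (sub_ne_zero.2 hxy)
  set r := ‖x - y‖ with hrdef
  have hξ : r⁻¹ • (x - y) ∈ Metric.sphere (0 : Euc N) 1 := by
    rw [mem_sphere_zero_iff_norm, norm_smul, norm_inv, norm_norm, ← hrdef, inv_mul_cancel₀ hr.ne']
  have hξ' : -(r⁻¹ • (x - y)) ∈ Metric.sphere (0 : Euc N) 1 := by
    rw [mem_sphere_zero_iff_norm, norm_neg]
    exact mem_sphere_zero_iff_norm.1 hξ
  have ex := abs_integral_mul_shiftedBump_sub_le (ξ := ⟨_, hξ⟩) hu hder h1 hh hx hUx hr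
  have ey := abs_integral_mul_shiftedBump_sub_le (ξ := ⟨_, hξ'⟩) hu hder h1 hh hy hUy hr
  have heq : ∀ z, shiftedBump h ⟨_, hξ⟩ x r z = shiftedBump h ⟨_, hξ'⟩ y r z := by
    intro z
    simp only [shiftedBump]
    congr 2
    module
  simp only [← heq] at ey
  rw [abs_le] at ex ey ⊢
  constructor <;> linarith [ex.1, ex.2, ey.1, ey.2, mul_add r (explicitU h S g x).toReal
    (explicitU h S g y).toReal]

/-- The estimate of difference quotients for the explicit function `U`; the exceptional set consists
of the points where `U` is infinite and of the points which are not Lebesgue points of `u`. -/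
theorem memM1_explicitU_and_abs_sub_le {m : ℕ} {u : Euc N → ℝ} (hu : LocallyIntegrable u volume)
    {S : Fin N → Fin m → FundamentalKernel N} {g : Fin N → Fin m → SignedMeasure (Euc N)}
    (hder : ∀ j : Fin N, HasDistribPartial u j (∑ k, (S j k).apply (g j k)))
    (h1 : ∫ y, h y = 1) (hh : tsupport h ⊆ Metric.ball 0 (1 / 2)) :
    MemM1 (explicitU h S g) ∧
      ∃ 𝒩 : Set (Euc N), volume 𝒩 = 0 ∧ (∀ x ∉ 𝒩, explicitU h S g x < ⊤) ∧
        ∀ x ∉ 𝒩, ∀ y ∉ 𝒩, |u x - u y| ≤ ‖x - y‖ *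
          ((explicitU h S g x).toReal + (explicitU h S g y).toReal) := by
  have hM : MemM1 (explicitU h S g) := by
    rcases eq_or_ne N 0 with rfl | hN
    · have e : explicitU h S g = fun _ => 0 := funext fun x => by simp [explicitU]
      rw [e]
      exact memM1_zero
    · exact memM1_explicitU hN hh S g
  have hL : ∀ᵐ x : Euc N,
      Tendsto (fun ε : ℝ => ⨍ z in Metric.closedBall x ε, ‖u z - u x‖) (𝓝[>] 0) (𝓝 0) := by
    filter_upwards [IsUnifLocDoublingMeasure.ae_tendsto_average_norm_sub volume hu 1] with x hx
    refine hx (fun _ => x) id tendsto_id ?_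
    filter_upwards [self_mem_nhdsWithin] with ε hε
    exact Metric.mem_closedBall_self (by simpa using le_of_lt hε)
  refine ⟨hM, {x | explicitU h S g x = ⊤} ∪ {x | ¬ Tendsto (fun ε : ℝ =>
    ⨍ z in Metric.closedBall x ε, ‖u z - u x‖) (𝓝[>] 0) (𝓝 0)},
    measure_union_null hM.ae_lt_top hL, ?_, ?_⟩
  · intro x hx
    exact lt_top_iff_ne_top.2 fun h2 => hx (Or.inl h2)
  · intro x hx y hy
    exact abs_sub_le_mul_explicitU hu hder h1 hh
      (by_contra fun h2 => hx (Or.inr h2)) (by_contra fun h2 => hy (Or.inr h2))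
      (lt_top_iff_ne_top.2 fun h2 => hx (Or.inl h2))
      (lt_top_iff_ne_top.2 fun h2 => hy (Or.inl h2))

lemma exists_testFunction_integral_eq_one (N : ℕ) :
    ∃ h : 𝓓((⊤ : TopologicalSpace.Opens (Euc N)), ℝ),
      ∫ y, h y = 1 ∧ tsupport h ⊆ Metric.ball 0 (1 / 2) := by
  let b : ContDiffBump (0 : Euc N) := ⟨1 / 8, 1 / 4, by norm_num, by norm_num⟩
  refine ⟨⟨b.normed volume, b.contDiff_normed, b.hasCompactSupport_normed, fun _ _ => trivial⟩,
    b.integral_normed, ?_⟩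
  change tsupport (b.normed volume) ⊆ _
  rw [b.tsupport_normed_eq]
  exact Metric.closedBall_subset_ball (by norm_num [b])

end DiffQuot
end

theorem proposition4p2 (N m : ℕ) (u : DiffQuot.Euc N → ℝ)
    (hu : LocallyIntegrable u volume)
    (S : Fin N → Fin m → DiffQuot.FundamentalKernel N)
    (g : Fin N → Fin m → SignedMeasure (DiffQuot.Euc N))
    (hder : ∀ j : Fin N, DiffQuot.HasDistribPartial u j (∑ k, (S j k).apply (g j k))) :
    (∃ U : DiffQuot.Euc N → ℝ, (∀ x, 0 ≤ U x) ∧ DiffQuot.MemM1 U ∧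
      ∃ 𝒩 : Set (DiffQuot.Euc N), volume 𝒩 = 0 ∧
        ∀ x ∉ 𝒩, ∀ y ∉ 𝒩, |u x - u y| ≤ ‖x - y‖ * (U x + U y)) ∧
    ∀ h : 𝓓((⊤ : TopologicalSpace.Opens (DiffQuot.Euc N)), ℝ),
      ∫ y, h y = 1 → tsupport h ⊆ Metric.ball 0 (1 / 2) →
      DiffQuot.MemM1 (DiffQuot.explicitU h S g) ∧
      ∃ 𝒩 : Set (DiffQuot.Euc N), volume 𝒩 = 0 ∧
        (∀ x ∉ 𝒩, DiffQuot.explicitU h S g x < ⊤) ∧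
        ∀ x ∉ 𝒩, ∀ y ∉ 𝒩, |u x - u y| ≤ ‖x - y‖ *
          ((DiffQuot.explicitU h S g x).toReal + (DiffQuot.explicitU h S g y).toReal) := by
  refine ⟨?_, fun h h1 hh => DiffQuot.memM1_explicitU_and_abs_sub_le hu hder h1 hh⟩
  obtain ⟨h, h1, hh⟩ := DiffQuot.exists_testFunction_integral_eq_one N
  obtain ⟨hM, 𝒩, h0, -, hest⟩ := DiffQuot.memM1_explicitU_and_abs_sub_le hu hder h1 hh
  exact ⟨fun x => (DiffQuot.explicitU h S g x).toReal, fun x => ENNReal.toReal_nonneg, hM.toReal,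
    𝒩, h0, hest⟩
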